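/- Let $\mathcal H_s$ and $\mathcal H_e$ be finite-dimensional complex Hilbert spaces (system and environment), and let $\mathcal D_{se}$ be a set of density operators on $\mathcal H_s\otimes\mathcal H_e$ on which the partial trace $\operatorname{tr}_e$ is one-to-one. Put $\mathcal D_s=\{\operatorname{tr}_e\rho_{se}:\rho_{se}\in\mathcal D_{se}\}$ and let the assignment map $\Lambda:\mathcal D_s\to\mathcal D_{se}$ be the inverse of $\operatorname{tr}_e|_{\mathcal D_{se}}$. A map from $\mathcal D_s$ to the density operators on a finite-dimensional Hilbert space $\mathcal K$ is said to admit a CP extension if it agrees on $\mathcal D_s$ with a linear map $\mathcal B(\mathcal H_s)\to\mathcal B(\mathcal K)$ that is completely positive and trace-preserving. Then the following statements are equivalent. (a) For every unitary operator $U$ on $\mathcal H_s\otimes\mathcal H_e$ and every tensor factorization $\mathcal H_s\otimes\mathcal H_e=\mathcal H_{s'}\otimes\mathcal H_{e'}$, the generalized reduced dynamical map $\mathcal D_s\ni\rho_s\mapsto\operatorname{tr}_{e'}\bigl(U\Lambda(\rho_s)U^\dagger\bigr)$ admits a CP extension. (b) The assignment map $\Lambda$ admits a CP extension. (c) There exist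 an orthogonal decomposition $\mathcal H_s=\bigoplus_j\mathcal H_{l_j}\otimes\mathcal H_{r_j}$ (finitely many $j$, all $\mathcal H_{l_j},\mathcal H_{r_j}$ nonzero) and fixed density operators $\tilde\omega_{r_je}$ on $\mathcal H_{r_j}\otimes\mathcal H_e$ such that every $\rho_{se}\in\mathcal D_{se}$ can be written as $$\rho_{se}=\bigoplus_j p_j\,\rho_{l_j}\otimes\tilde\omega_{r_je}$$ with a probability distribution $\{p_j\}$ and density operators $\rho_{l_j}$ on $\mathcal H_{l_j}$. -/

import Mathlib

open scoped Kronecker ComplexOrder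

namespace ReducedDynamics

/-- Density operators on the Hilbert space `ℂ^ι`: positive semidefinite with unit trace. -/
def IsDensity {ι : Type*} [Fintype ι] (ρ : Matrix ι ι ℂ) : Prop :=
  ρ.PosSemidef ∧ ρ.trace = 1

/-- The partial trace over the second tensor factor of `ℂ^σ ⊗ ℂ^ε`. -/
def partialTrace {σ ε : Type*} [Fintype ε] :
    Matrix (σ × ε) (σ × ε) ℂ →ₗ[ℂ] Matrix σ σ ℂ where
  toFun X := Matrix.of fun a b => ∑ i, X (a, i) (b, i)
  map_add' X Y := by
    ext a b
    simp [Finset.sum_add_distrib]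
  map_smul' c X := by
    ext a b
    simp [Finset.mul_sum]

/-- The map `id_n ⊗ Φ` on the operators on `ℂ^n ⊗ ℂ^ι`, that is, `Φ` applied to each of the
`n × n` blocks. -/
def idTensor {ι κ : Type*} (n : ℕ) (Φ : Matrix ι ι ℂ →ₗ[ℂ] Matrix κ κ ℂ)
    (X : Matrix (Fin n × ι) (Fin n × ι) ℂ) : Matrix (Fin n × κ) (Fin n × κ) ℂ :=
  Matrix.of fun p q => Φ (Matrix.of fun a b => X (p.1, a) (q.1, b)) p.2 q.2

/-- Complete positivity: `id_n ⊗ Φ` preserves positive semidefiniteness for every `n`. -/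
def IsCP {ι κ : Type*} (Φ : Matrix ι ι ℂ →ₗ[ℂ] Matrix κ κ ℂ) : Prop :=
  ∀ (n : ℕ) (X : Matrix (Fin n × ι) (Fin n × ι) ℂ), X.PosSemidef → (idTensor n Φ X).PosSemidef

/-- Quantum operations: completely positive, trace-preserving linear maps.  These are the
completely positive linear maps from the density operators of one system to the density
operators of another. -/
def IsQuantumOperation {ι κ : Type*} [Fintype ι] [Fintype κ]
    (Φ : Matrix ι ι ℂ →ₗ[ℂ] Matrix κ κ ℂ) : Prop :=
  IsCP Φ ∧ ∀ X, (Φ X).trace = X.trace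

/-- `W` is a unitary map of `ℂ^ι` onto `ℂ^κ`. -/
def IsUnitaryMap {ι κ : Type*} [Fintype ι] [Fintype κ] [DecidableEq ι] [DecidableEq κ]
    (W : Matrix κ ι ℂ) : Prop :=
  W.conjTranspose * W = 1 ∧ W * W.conjTranspose = 1

/-- The reduced initial states of a set `D` of joint initial states. -/
def reducedStates {S E : Type*} [Fintype E] (D : Set (Matrix (S × E) (S × E) ℂ)) :
    Set (Matrix S S ℂ) :=
  partialTrace '' D

/-- The assignment map `Λ`: the inverse of the partial trace restricted to `D`, on which the
partial trace is one-to-one. -/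
noncomputable def assignment {S E : Type*} [Fintype E] (D : Set (Matrix (S × E) (S × E) ℂ))
    (hD : Set.InjOn (partialTrace (σ := S) (ε := E)) D) : reducedStates D → D :=
  (Equiv.Set.imageOfInjOn partialTrace D hD).symm

/-- The map `f`, defined on a set `A` of density operators, admits a completely positive
description: it extends to a completely positive map on all density operators. -/
def HasCPExtension {ι κ : Type*} [Fintype ι] [Fintype κ] (A : Set (Matrix ι ι ℂ))
    (f : A → Matrix κ κ ℂ) : Prop :=
  ∃ Φ : Matrix ι ι ℂ →ₗ[ℂ] Matrix κ κ ℂ, IsQuantumOperation Φ ∧ ∀ ρ : A, Φ ρ = f ρ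

/-- The generalized reduced dynamical map `ρ_s ↦ tr_{e'} (U Λ(ρ_s) U†)` for the joint unitary
evolution `U` and the final partition `H_s ⊗ H_e = H_{s'} ⊗ H_{e'}`, where the unitary `W`
carries out the identification of the two tensor products. -/
noncomputable def reducedMap {S E S' E' : Type*} [Fintype S] [Fintype E] [Fintype E']
    (D : Set (Matrix (S × E) (S × E) ℂ))
    (hD : Set.InjOn (partialTrace (σ := S) (ε := E)) D)
    (W : Matrix (S' × E') (S × E) ℂ) (U : Matrix (S × E) (S × E) ℂ) :
    reducedStates D → Matrix S' S' ℂ :=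
  fun ρ => partialTrace
    (W * (U * (assignment D hD ρ : Matrix (S × E) (S × E) ℂ) * U.conjTranspose)
      * W.conjTranspose)

/-- Every generalized reduced dynamical map, for every joint unitary and every
system-environment partition at the final time, admits a completely positive description. -/
def GuaranteesCP {S E : Type*} [Fintype S] [Fintype E] [DecidableEq S] [DecidableEq E]
    (D : Set (Matrix (S × E) (S × E) ℂ))
    (hD : Set.InjOn (partialTrace (σ := S) (ε := E)) D) : Prop :=
  ∀ (s' e' : ℕ) (W : Matrix (Fin s' × Fin e') (S × E) ℂ) (U : Matrix (S × E) (S × E) ℂ),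
    IsUnitaryMap W → IsUnitaryMap U →
      HasCPExtension (reducedStates D) (reducedMap D hD W U)

/-- The assignment map admits a completely positive extension to all density operators. -/
def HasCPAssignment {S E : Type*} [Fintype S] [Fintype E]
    (D : Set (Matrix (S × E) (S × E) ℂ))
    (hD : Set.InjOn (partialTrace (σ := S) (ε := E)) D) : Prop :=
  HasCPExtension (reducedStates D) fun ρ => (assignment D hD ρ : Matrix (S × E) (S × E) ℂ)

/-- The identification of index sets underlying
`⨁ j, H_{l_j} ⊗ (H_{r_j} ⊗ H_e) = (⨁ j, H_{l_j} ⊗ H_{r_j}) ⊗ H_e`. -/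
def blockEquiv {n : ℕ} (l r : Fin n → ℕ) (E : Type*) :
    (Σ j, Fin (l j) × (Fin (r j) × E)) ≃ (Σ j, Fin (l j) × Fin (r j)) × E :=
  (Equiv.sigmaCongrRight fun j => (Equiv.prodAssoc (Fin (l j)) (Fin (r j)) E).symm).trans
    (Equiv.sigmaProdDistrib (fun j => Fin (l j) × Fin (r j)) E).symm

/-- The operator `⨁ j, p_j σ_j ⊗ ω_j` on `(⨁ j, H_{l_j} ⊗ H_{r_j}) ⊗ H_e`, where `σ_j` acts on
`H_{l_j}` and `ω_j` acts on `H_{r_j} ⊗ H_e`. -/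
noncomputable def blockState {n : ℕ} {l r : Fin n → ℕ} {E : Type*} (p : Fin n → ℝ)
    (σ : ∀ j, Matrix (Fin (l j)) (Fin (l j)) ℂ)
    (ω : ∀ j, Matrix (Fin (r j) × E) (Fin (r j) × E) ℂ) :
    Matrix ((Σ j, Fin (l j) × Fin (r j)) × E) ((Σ j, Fin (l j) × Fin (r j)) × E) ℂ :=
  Matrix.reindex (blockEquiv l r E) (blockEquiv l r E)
    (Matrix.blockDiagonal' fun j => (p j : ℂ) • (σ j ⊗ₖ ω j))

/-- There are a decomposition `H_s = ⨁ j, H_{l_j} ⊗ H_{r_j}` into nonzero spaces, given by a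
unitary map `V`, and fixed density operators `ω_j` on `H_{r_j} ⊗ H_e`, such that every state in
`D` has the form `⨁ j, p_j σ_j ⊗ ω_j` with a probability distribution `p` and density operators
`σ_j` on `H_{l_j}`. -/
def HasBlockForm {S E : Type*} [Fintype S] [Fintype E] [DecidableEq S] [DecidableEq E]
    (D : Set (Matrix (S × E) (S × E) ℂ)) : Prop :=
  ∃ (n : ℕ) (l r : Fin n → ℕ) (V : Matrix (Σ j, Fin (l j) × Fin (r j)) S ℂ)
    (ω : ∀ j, Matrix (Fin (r j) × E) (Fin (r j) × E) ℂ),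
    (∀ j, 0 < l j ∧ 0 < r j) ∧ IsUnitaryMap V ∧ (∀ j, IsDensity (ω j)) ∧
      ∀ ρ ∈ D, ∃ (p : Fin n → ℝ) (σ : ∀ j, Matrix (Fin (l j)) (Fin (l j)) ℂ),
        (∀ j, 0 ≤ p j) ∧ ∑ j, p j = 1 ∧ (∀ j, IsDensity (σ j)) ∧
          (V ⊗ₖ (1 : Matrix E E ℂ)) * ρ * (V ⊗ₖ (1 : Matrix E E ℂ)).conjTranspose
            = blockState p σ ω

end ReducedDynamics

/-! Statements (a) and (b) differ only in what is discarded at the end. If Λ extends to a channel,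
composing it with conjugation by `U` and a partial trace gives (a); conversely, with `U = 1` and a
one-dimensional final environment the reduced map is Λ itself up to relabelling. From (c) to (b),
the channel that keeps the diagonal blocks, traces out each r_j and inserts ω_j restores every state
of block form from its reduction (`blockChannel`).

The substance is (b) to (c). Let Φ be a channel extending Λ. Then tr_e ∘ Φ fixes every reduced
state, and its Kraus operators K (m, e) are the environment slices of those of Φ. Let P be the
projection onto the joint support of the reduced states and L = K P. A fixed point Y of the dual map
X ↦ ∑ L† X L commutes with every L, because the traces of [L, Y] ρ [L, Y]† sum to zero for each
invariant ρ (`commute_kraus_of_dual_fixed`); the same for Y† gives commutation with L†.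

The family of all L and L† is unitarily ⨁ j, 1 ⊗ t' j with irreducible, pairwise inequivalent t' j
(`exists_isotypic_decomposition`). So the dual map has no nonzero fixed points between different j
and only scalar ones within one j. A square matrix and its adjoint have kernels of equal dimension,
which carries this over to the map itself: blocks of an invariant state vanish between different j,
and within one j are multiples of a single density operator. Applying the Kraus slices to that
operator without summing over the environment yields ω_j (`exists_invariant_block_structure`). -/

namespace ReducedDynamics

open Matrix

/-! ### Orthogonal decomposition into irreducible subspaces -/

section Irreducible

variable {V τ : Type*} [NormedAddCommGroup V] [InnerProductSpace ℂ V]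

/-- `W` is invariant under all operators `T i`. -/
def IsInvariant (T : τ → V →ₗ[ℂ] V) (W : Submodule ℂ V) : Prop :=
  ∀ i, ∀ w ∈ W, T i w ∈ W

/-- `W` is a minimal nonzero invariant subspace for the operators `T i`. -/
def IsIrreducibleSubspace (T : τ → V →ₗ[ℂ] V) (W : Submodule ℂ V) : Prop :=
  IsInvariant T W ∧ W ≠ ⊥ ∧ ∀ W' ≤ W, IsInvariant T W' → W' ≠ ⊥ → W' = W

theorem IsInvariant.orthogonal [FiniteDimensional ℂ V] {T : τ → V →ₗ[ℂ] V}
    (hT : ∀ i, ∃ i', T i' = LinearMap.adjoint (T i)) {W : Submodule ℂ V}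
    (hW : IsInvariant T W) : IsInvariant T Wᗮ := by
  intro i w hw
  rw [Submodule.mem_orthogonal] at hw ⊢
  intro u hu
  obtain ⟨i', hi'⟩ := hT i
  rw [← LinearMap.adjoint_inner_left, ← hi']
  exact hw _ (hW i' u hu)

theorem exists_isIrreducibleSubspace_le [FiniteDimensional ℂ V] (T : τ → V →ₗ[ℂ] V)
    {U : Submodule ℂ V} (hU : IsInvariant T U) (hne : U ≠ ⊥) :
    ∃ W ≤ U, IsIrreducibleSubspace T W := by
  induction U using WellFoundedLT.induction with
  | ind U ih =>
    by_cases h : ∀ W' ≤ U, IsInvariant T W' → W' ≠ ⊥ → W' = U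
    · exact ⟨U, le_rfl, hU, hne, h⟩
    · push Not at h
      obtain ⟨W', hle, hinv, hne', hneq⟩ := h
      obtain ⟨W, hW, hirr⟩ := ih W' (lt_of_le_of_ne hle hneq) hinv hne'
      exact ⟨W, hW.trans hle, hirr⟩

/-- Closure under adjoints makes the orthogonal complement of a minimal invariant subspace
invariant, so one can be split off and the strictly smaller remainder handled by induction. -/
theorem exists_orthogonal_irreducible [FiniteDimensional ℂ V] {T : τ → V →ₗ[ℂ] V}
    (hT : ∀ i, ∃ i', T i' = LinearMap.adjoint (T i)) {U : Submodule ℂ V}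
    (hU : IsInvariant T U) :
    ∃ s : Set (Submodule ℂ V), s.Finite ∧ (∀ W ∈ s, IsIrreducibleSubspace T W) ∧
      s.Pairwise (· ⟂ ·) ∧ sSup s = U := by
  induction U using WellFoundedLT.induction with
  | ind U ih =>
    by_cases hne : U = ⊥
    · exact ⟨∅, by simp, by simp, by simp, by simp [hne]⟩
    obtain ⟨W, hWU, hW⟩ := exists_isIrreducibleSubspace_le T hU hne
    have hinv : IsInvariant T (Wᗮ ⊓ U) := fun i w hw =>
      ⟨hW.1.orthogonal hT i w hw.1, hU i w hw.2⟩
    have hsup : W ⊔ Wᗮ ⊓ U = U := Submodule.sup_orthogonal_inf_of_hasOrthogonalProjection hWU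
    have hlt : Wᗮ ⊓ U < U := by
      refine lt_of_le_of_ne inf_le_right fun h => hW.2.1 ?_
      have : W ≤ Wᗮ := hWU.trans (h ▸ inf_le_left)
      rw [eq_bot_iff, ← W.inf_orthogonal_eq_bot]
      exact le_inf le_rfl this
    obtain ⟨s, hfin, hirr, hpair, hs⟩ := ih _ hlt hinv
    refine ⟨insert W s, hfin.insert W, ?_, ?_, ?_⟩
    · rintro W' (rfl | h)
      · exact hW
      · exact hirr _ h
    · refine (Set.pairwise_insert_of_symm).2 ⟨hpair, fun W' hW' _ => ?_⟩
      have : W' ≤ Wᗮ := (le_sSup hW').trans (hs.le.trans inf_le_left)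
      exact (Submodule.isOrtho_iff_le.2 this).symm
    · rw [sSup_insert, hs, hsup]

/-- A self-adjoint family of operators is an orthogonal direct sum of families of matrices with
scalar commutant. -/
theorem exists_irreducible_orthonormalBasis [FiniteDimensional ℂ V] {T : τ → V →ₗ[ℂ] V}
    (hT : ∀ i, ∃ i', T i' = LinearMap.adjoint (T i)) :
    ∃ (s : Set (Submodule ℂ V)) (_ : Fintype s) (d : s → ℕ)
      (b : OrthonormalBasis (Σ a, Fin (d a)) ℂ V)
      (t' : ∀ a, τ → Matrix (Fin (d a)) (Fin (d a)) ℂ),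
      (∀ a, 0 < d a) ∧ (∀ i a x, T i (b ⟨a, x⟩) = ∑ y, t' a i y x • b ⟨a, y⟩) ∧
      ∀ a (x : Matrix (Fin (d a)) (Fin (d a)) ℂ), (∀ i, t' a i * x = x * t' a i) →
        ∃ c : ℂ, x = c • 1 := by
  classical
  obtain ⟨s, hfin, hirr, hpair, hs⟩ :=
    exists_orthogonal_irreducible hT (U := ⊤) (fun _ _ _ => trivial)
  have : Fintype s := hfin.fintype
  let A : s → Submodule ℂ V := fun W => W.1
  have hortho : OrthogonalFamily ℂ (fun W => A W) fun W => (A W).subtypeₗᵢ := by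
    intro W W' hne x y
    exact (hpair W.2 W'.2 fun h => hne (Subtype.ext h)).inner_eq x.2 y.2
  have hint : DirectSum.IsInternal A := by
    rw [hortho.isInternal_iff]
    have : iSup A = ⊤ := by rw [← hs, sSup_eq_iSup']
    rw [this, Submodule.top_orthogonal_eq_bot]
  obtain ⟨b, hbmem⟩ : ∃ b : OrthonormalBasis (Σ W, Fin (Module.finrank ℂ (A W))) ℂ V,
      ∀ W x, b ⟨W, x⟩ ∈ A W :=
    ⟨hint.collectedOrthonormalBasis hortho fun W => stdOrthonormalBasis ℂ (A W), fun W x =>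
      hint.collectedOrthonormalBasis_mem hortho (fun W => stdOrthonormalBasis ℂ (A W)) ⟨W, x⟩⟩
  let t' : ∀ W, τ → Matrix (Fin (Module.finrank ℂ (A W))) (Fin (Module.finrank ℂ (A W))) ℂ :=
    fun W i => Matrix.of fun y x => inner ℂ (b ⟨W, y⟩) (T i (b ⟨W, x⟩))
  have hTb : ∀ i W x, T i (b ⟨W, x⟩) = ∑ y, t' W i y x • b ⟨W, y⟩ := by
    intro i W x
    rw [← b.sum_repr' (T i (b ⟨W, x⟩)), Fintype.sum_sigma, Finset.sum_eq_single W]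
    · rfl
    · intro W' _ hne
      refine Finset.sum_eq_zero fun y _ => ?_
      rw [(hpair W'.2 W.2 fun h => hne (Subtype.ext h)).inner_eq (hbmem W' y)
        ((hirr _ W.2).1 i _ (hbmem W x)), zero_smul]
    · simp
  have hpos : ∀ W, 0 < Module.finrank ℂ (A W) := fun W =>
    Module.finrank_pos_iff.2 ((Submodule.nontrivial_iff_ne_bot).2 (hirr _ W.2).2.1)
  refine ⟨s, inferInstance, fun W => Module.finrank ℂ (A W), b, t', hpos, hTb, ?_⟩
  intro W x hx
  have hne : Nonempty (Fin (Module.finrank ℂ (A W))) := ⟨⟨0, hpos W⟩⟩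
  obtain ⟨c, hc⟩ := Module.End.exists_eigenvalue (Matrix.toLin' x)
  refine ⟨c, ?_⟩
  let F : (Fin (Module.finrank ℂ (A W)) → ℂ) →ₗ[ℂ] V :=
    Fintype.linearCombination ℂ fun y => b ⟨W, y⟩
  have hFapp : ∀ v, F v = ∑ y, v y • b ⟨W, y⟩ := fun v => Fintype.linearCombination_apply ..
  have hF : Function.Injective F := by
    have : LinearIndependent ℂ fun y => b ⟨W, y⟩ :=
      b.orthonormal.linearIndependent.comp (fun y => (⟨W, y⟩ : Σ W, Fin (Module.finrank ℂ (A W))))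
        fun _ _ h => by simpa using h
    exact LinearIndependent.fintypeLinearCombination_injective this
  have hFmem : ∀ v, F v ∈ W.1 := fun v => by
    rw [hFapp]
    exact Submodule.sum_mem _ fun y _ => Submodule.smul_mem _ _ (hbmem W y)
  have hTF : ∀ i v, T i (F v) = F (t' W i *ᵥ v) := by
    intro i v
    rw [hFapp, hFapp]
    simp only [map_sum, map_smul, hTb, Matrix.mulVec, dotProduct, Finset.smul_sum, Finset.sum_smul,
      smul_smul]
    rw [Finset.sum_comm]
    refine Finset.sum_congr rfl fun y _ => Finset.sum_congr rfl fun z _ => ?_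
    rw [mul_comm]
  -- An eigenspace of `x` is stable under the commuting `t' W i`; `F` carries it to a nonzero
  -- invariant subspace of `W`, which is all of `W` by minimality. Hence `x` is scalar.
  let E := Module.End.eigenspace (Matrix.toLin' x) c
  have hE : ∀ v, v ∈ E ↔ x *ᵥ v = c • v := fun v => by
    rw [Module.End.mem_eigenspace_iff, Matrix.toLin'_apply]
  have hmap : E.map F = W.1 := by
    refine (hirr _ W.2).2.2 _ ?_ ?_ ?_
    · rintro _ ⟨v, -, rfl⟩
      exact hFmem v
    · rintro i _ ⟨v, hv, rfl⟩
      rw [hTF]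
      refine ⟨_, (hE _).2 ?_, rfl⟩
      rw [Matrix.mulVec_mulVec, ← hx i, ← Matrix.mulVec_mulVec, (hE v).1 hv, Matrix.mulVec_smul]
    · intro h
      exact hc (Submodule.map_injective_of_injective hF (h.trans (Submodule.map_bot F).symm))
  have htop : ∀ v, v ∈ E := by
    intro v
    have : F v ∈ E.map F := hmap ▸ hFmem v
    obtain ⟨w, hw, hwv⟩ := this
    exact hF hwv ▸ hw
  refine Matrix.ext_of_mulVec_single fun y => ?_
  rw [(hE _).1 (htop _), Matrix.smul_mulVec, Matrix.one_mulVec]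

end Irreducible

/-- Every self-adjoint family of matrices is unitarily equivalent to a direct sum of families
with scalar commutant. -/
theorem exists_irreducible_decomposition.{u} {S : Type u} {τ : Type*} [Fintype S] [DecidableEq S]
    (t : τ → Matrix S S ℂ) (ht : ∀ i, ∃ i', t i' = (t i)ᴴ) :
    ∃ (ι : Type u) (_ : Fintype ι) (_ : DecidableEq ι) (d : ι → ℕ)
      (B : Matrix S (Σ a, Fin (d a)) ℂ) (t' : ∀ a, τ → Matrix (Fin (d a)) (Fin (d a)) ℂ),
      (∀ a, 0 < d a) ∧ Bᴴ * B = 1 ∧ Fintype.card S = Fintype.card (Σ a, Fin (d a)) ∧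
      (∀ i s a x, (t i * B) s ⟨a, x⟩ = ∑ y, B s ⟨a, y⟩ * t' a i y x) ∧
      ∀ a (x : Matrix (Fin (d a)) (Fin (d a)) ℂ), (∀ i, t' a i * x = x * t' a i) →
        ∃ c : ℂ, x = c • 1 := by
  classical
  have hT : ∀ i, ∃ i', (t i').toEuclideanLin = LinearMap.adjoint (t i).toEuclideanLin := fun i => by
    obtain ⟨i', hi'⟩ := ht i
    exact ⟨i', by rw [hi', Matrix.toEuclideanLin_conjTranspose_eq_adjoint]⟩
  obtain ⟨s, hfin, d, b, t', hd, hb, hirr⟩ := exists_irreducible_orthonormalBasis hT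
  refine ⟨s, hfin, inferInstance, d, Matrix.of fun s a => b a s, t', hd, ?_, ?_, ?_, hirr⟩
  · ext a a'
    have := orthonormal_iff_ite.1 b.orthonormal a a'
    rw [Matrix.one_apply, ← this]
    simp [Matrix.mul_apply, PiLp.inner_apply, mul_comm]
  · rw [← Module.finrank_eq_card_basis b.toBasis, finrank_euclideanSpace]
  · intro i σ a x
    have := congrArg (fun v : EuclideanSpace ℂ S => v σ) (hb i a x)
    simp only [Matrix.toLpLin_apply] at this
    simpa [Matrix.mul_apply, Matrix.mulVec, dotProduct, mul_comm] using this

/-! ### Intertwiners and Schur's lemma -/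

section Schur

variable {α β γ τ : Type*} [Fintype α] [Fintype β] [Fintype γ]

/-- `x` intertwines the families of matrices `f` and `g`. -/
def Intertwines (f : τ → Matrix α α ℂ) (g : τ → Matrix β β ℂ) (x : Matrix α β ℂ) : Prop :=
  ∀ i, f i * x = x * g i

theorem Intertwines.conjTranspose {f : τ → Matrix α α ℂ} {g : τ → Matrix β β ℂ}
    {star' : τ → τ} (hf : ∀ i, f (star' i) = (f i)ᴴ) (hg : ∀ i, g (star' i) = (g i)ᴴ)
    {x : Matrix α β ℂ} (hx : Intertwines f g x) : Intertwines g f xᴴ := by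
  intro i
  have := congrArg Matrix.conjTranspose (hx (star' i))
  simpa [hf, hg] using this.symm

theorem Intertwines.mul {f : τ → Matrix α α ℂ} {g : τ → Matrix β β ℂ} {h : τ → Matrix γ γ ℂ}
    {x : Matrix α β ℂ} {y : Matrix β γ ℂ} (hx : Intertwines f g x) (hy : Intertwines g h y) :
    Intertwines f h (x * y) := by
  intro i
  rw [← Matrix.mul_assoc, hx i, Matrix.mul_assoc, hy i, Matrix.mul_assoc]

/-- **Schur's lemma** for self-adjoint families of matrices: a nonzero intertwiner of families
with scalar commutant is a multiple of a unitary. -/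
theorem exists_unitary_intertwiner [DecidableEq α] [DecidableEq β] [Nonempty β]
    {f : τ → Matrix α α ℂ} {g : τ → Matrix β β ℂ}
    {star' : τ → τ} (hf : ∀ i, f (star' i) = (f i)ᴴ) (hg : ∀ i, g (star' i) = (g i)ᴴ)
    (hfc : ∀ x, Intertwines f f x → ∃ c : ℂ, x = c • 1)
    (hgc : ∀ x, Intertwines g g x → ∃ c : ℂ, x = c • 1)
    {x : Matrix α β ℂ} (hx : Intertwines f g x) (hne : x ≠ 0) :
    ∃ u : Matrix α β ℂ, Intertwines f g u ∧ uᴴ * u = 1 ∧ u * uᴴ = 1 := by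
  obtain ⟨c, hc⟩ := hgc _ ((hx.conjTranspose hf hg).mul hx)
  obtain ⟨c', hc'⟩ := hfc _ (hx.mul (hx.conjTranspose hf hg))
  -- Both scalars are read off from x x† x, bracketed in two ways.
  have hcc : c = c' := by
    have h : c • x = c' • x := by
      calc c • x = x * (xᴴ * x) := by rw [hc]; simp
        _ = c' • x := by rw [← Matrix.mul_assoc, hc']; simp
    by_contra hne'
    exact hne ((smul_eq_zero.1 (by rw [sub_smul, h, sub_self] : (c - c') • x = 0)).resolve_left
      (sub_ne_zero.2 hne'))
  have hc0 : 0 ≤ c := by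
    obtain ⟨b⟩ := ‹Nonempty β›
    have := (posSemidef_conjTranspose_mul_self x).diag_nonneg (i := b)
    simpa [hc] using this
  have hcne : c ≠ 0 := by
    rintro rfl
    rw [zero_smul, Matrix.conjTranspose_mul_self_eq_zero] at hc
    exact hne hc
  obtain ⟨r, hr, rfl⟩ : ∃ r : ℝ, 0 ≤ r ∧ c = r := by
    refine ⟨c.re, (Complex.le_def.1 hc0).1, ?_⟩
    exact Complex.ext rfl (by simpa using (Complex.le_def.1 hc0).2.symm)
  have hr0 : r ≠ 0 := fun h => hcne (by simp [h])
  have hs : ((Real.sqrt r : ℂ))⁻¹ * ((Real.sqrt r : ℂ))⁻¹ * r = 1 := by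
    rw [← mul_inv, ← Complex.ofReal_mul, Real.mul_self_sqrt hr]
    exact inv_mul_cancel₀ (by exact_mod_cast hr0)
  have hst : star ((Real.sqrt r : ℂ))⁻¹ = ((Real.sqrt r : ℂ))⁻¹ := by simp
  refine ⟨((Real.sqrt r : ℂ))⁻¹ • x, fun i => ?_, ?_, ?_⟩
  · rw [Matrix.mul_smul, hx i, Matrix.smul_mul]
  · simp only [Matrix.conjTranspose_smul, hst, Matrix.smul_mul, Matrix.mul_smul, hc, smul_smul]
    rw [← mul_assoc, hs, one_smul]
  · simp only [Matrix.conjTranspose_smul, hst, Matrix.smul_mul, Matrix.mul_smul, hc', ← hcc, smul_smul]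
    rw [← mul_assoc, hs, one_smul]

end Schur

/-! ### Isotypic decomposition -/

/-- The structure theorem for self-adjoint families of matrices `t`: in a suitable orthonormal
basis, the columns of `B`, they are simultaneously of the form `⨁ j, 1 ⊗ t' j`, where the families
`t' j` have scalar commutant and are pairwise disjoint. -/
theorem exists_isotypic_decomposition {S τ : Type*} [Fintype S] [DecidableEq S]
    (t : τ → Matrix S S ℂ) (star' : τ → τ) (ht : ∀ i, t (star' i) = (t i)ᴴ) :
    ∃ (n : ℕ) (l r : Fin n → ℕ) (B : Matrix S (Σ j, Fin (l j) × Fin (r j)) ℂ)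
      (t' : ∀ j, τ → Matrix (Fin (r j)) (Fin (r j)) ℂ),
      (∀ j, 0 < l j ∧ 0 < r j) ∧ Bᴴ * B = 1 ∧ B * Bᴴ = 1 ∧
      (∀ j i, t' j (star' i) = (t' j i)ᴴ) ∧
      (∀ i s j a x, (t i * B) s ⟨j, (a, x)⟩ = ∑ y, B s ⟨j, (a, y)⟩ * t' j i y x) ∧
      (∀ j k (x : Matrix (Fin (r j)) (Fin (r k)) ℂ), Intertwines (t' j) (t' k) x →
        j ≠ k → x = 0) ∧
      ∀ j (x : Matrix (Fin (r j)) (Fin (r j)) ℂ), Intertwines (t' j) (t' j) x →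
        ∃ c : ℂ, x = c • 1 := by
  classical
  obtain ⟨ι, _, _, d, B, t', hd, hB, hcard, hblock, hirr⟩ :=
    exists_irreducible_decomposition t fun i => ⟨star' i, ht i⟩
  have hBent : ∀ a x a' y, ∑ s, star (B s ⟨a, x⟩) * B s ⟨a', y⟩ =
      if (⟨a, x⟩ : Σ a, Fin (d a)) = ⟨a', y⟩ then 1 else 0 := by
    intro a x a' y
    rw [← Matrix.one_apply, ← hB, Matrix.mul_apply]
    rfl
  have hentry : ∀ i a y x, t' a i y x = ∑ s, star (B s ⟨a, y⟩) * (t i * B) s ⟨a, x⟩ := by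
    intro i a y x
    simp only [hblock, Finset.mul_sum, ← mul_assoc]
    rw [Finset.sum_comm]
    simp only [← Finset.sum_mul, hBent]
    simp
  have hstar : ∀ a i, t' a (star' i) = (t' a i)ᴴ := by
    intro a i
    ext y x
    rw [Matrix.conjTranspose_apply, hentry, hentry, ht]
    simp only [Matrix.mul_apply, Finset.mul_sum, star_sum, star_mul', star_star,
      Matrix.conjTranspose_apply]
    rw [Finset.sum_comm]
    refine Finset.sum_congr rfl fun s _ => Finset.sum_congr rfl fun s' _ => ?_
    ring
  have hne : ∀ a, Nonempty (Fin (d a)) := fun a => ⟨⟨0, hd a⟩⟩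
  -- Irreducible summands are grouped by unitary equivalence; each class is one index j, and its
  -- cardinality is the multiplicity `l j`.
  let st : Setoid ι :=
    { r := fun a b => ∃ u : Matrix (Fin (d a)) (Fin (d b)) ℂ,
        Intertwines (t' a) (t' b) u ∧ uᴴ * u = 1 ∧ u * uᴴ = 1
      iseqv :=
        { refl := fun a => ⟨1, fun i => by simp, by simp, by simp⟩
          symm := by
            rintro a b ⟨u, hu, h1, h2⟩
            exact ⟨uᴴ, hu.conjTranspose (hstar a) (hstar b), by simpa using h2, by simpa using h1⟩
          trans := by
            rintro a b c ⟨u, hu, h1, h2⟩ ⟨v, hv, h3, h4⟩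
            refine ⟨u * v, hu.mul hv, ?_, ?_⟩
            · rw [Matrix.conjTranspose_mul, Matrix.mul_assoc, ← Matrix.mul_assoc uᴴ, h1,
                Matrix.one_mul, h3]
            · rw [Matrix.conjTranspose_mul, Matrix.mul_assoc, ← Matrix.mul_assoc v, h4,
                Matrix.one_mul, h2] } }
  let e : Fin (Fintype.card (Quotient st)) ≃ Quotient st := (Fintype.equivFin _).symm
  let l : Fin (Fintype.card (Quotient st)) → ℕ := fun j =>
    Fintype.card {a : ι // (Quotient.mk st a) = e j}
  let el : ∀ j, Fin (l j) ≃ {a : ι // (Quotient.mk st a) = e j} := fun j =>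
    (Fintype.equivFin _).symm
  let rep : Fin (Fintype.card (Quotient st)) → ι := fun j => (e j).out
  have hrep : ∀ j, Quotient.mk st (rep j) = e j := fun j => Quotient.out_eq _
  have hu : ∀ j (α : Fin (l j)), ∃ u : Matrix (Fin (d (el j α).1)) (Fin (d (rep j))) ℂ,
      Intertwines (t' (el j α).1) (t' (rep j)) u ∧ uᴴ * u = 1 ∧ u * uᴴ = 1 := fun j α =>
    Quotient.exact ((el j α).2.trans (hrep j).symm)
  choose u hui hu1 hu2 using hu
  -- Each summand's basis is rotated by its intertwiner with the class representative, so that the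
  -- family acts by the same matrices on all copies.
  let B' : Matrix S (Σ j, Fin (l j) × Fin (d (rep j))) ℂ :=
    Matrix.of fun s p => ∑ z, B s ⟨(el p.1 p.2.1).1, z⟩ * u p.1 p.2.1 z p.2.2
  have hB' : B'ᴴ * B' = 1 := by
    ext ⟨j, α, x⟩ ⟨k, β, y⟩
    have h1 : (B'ᴴ * B') ⟨j, α, x⟩ ⟨k, β, y⟩ = ∑ z, ∑ w, star (u j α z x) * u k β w y *
        if (⟨(el j α).1, z⟩ : Σ a, Fin (d a)) = ⟨(el k β).1, w⟩ then 1 else 0 := by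
      simp only [← hBent, B', Matrix.mul_apply, Matrix.conjTranspose_apply, Matrix.of_apply,
        star_sum, star_mul', Finset.sum_mul, Finset.mul_sum]
      rw [Finset.sum_comm]
      conv_rhs => rw [Finset.sum_comm]
      refine Fintype.sum_congr _ _ fun w => ?_
      rw [Finset.sum_comm]
      refine Fintype.sum_congr _ _ fun z => Fintype.sum_congr _ _ fun s => ?_
      ring
    rw [h1]
    by_cases hjk : j = k
    · subst hjk
      by_cases hab : α = β
      · subst hab
        have := congrFun (congrFun (hu1 j α) x) y
        simp only [Matrix.mul_apply, Matrix.conjTranspose_apply, Matrix.one_apply] at this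
        simpa [Matrix.one_apply] using this
      · have : (el j α).1 ≠ (el j β).1 := fun h => hab ((el j).injective (Subtype.ext h))
        simp [this, hab]
    · have : (el j α).1 ≠ (el k β).1 := fun h =>
        hjk (e.injective ((el j α).2.symm.trans ((congrArg _ h).trans (el k β).2)))
      simp [this, hjk]
  -- Comparing the traces of u† u and u u† shows that equivalent summands have equal size; the
  -- dimension count then makes `B'` square, hence unitary.
  have hdim : ∀ j (α : Fin (l j)), d (el j α).1 = d (rep j) := by
    intro j α
    have h1 := congrArg Matrix.trace (hu1 j α)
    have h2 := congrArg Matrix.trace (hu2 j α)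
    rw [Matrix.trace_mul_comm, h2] at h1
    simpa using h1
  have hcard' : Fintype.card S = Fintype.card (Σ j, Fin (l j) × Fin (d (rep j))) := by
    rw [hcard]
    simp only [Fintype.card_sigma, Fintype.card_prod, Fintype.card_fin]
    calc ∑ a, d a = ∑ q : Quotient st, ∑ a : {a : ι // (Quotient.mk st a) = q}, d a.1 := by
          rw [← Fintype.sum_sigma', ← (Equiv.sigmaFiberEquiv (Quotient.mk st)).sum_comp]
          rfl
      _ = ∑ j, ∑ a : {a : ι // (Quotient.mk st a) = e j}, d a.1 := (e.sum_comp _).symm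
      _ = ∑ j, ∑ α : Fin (l j), d (el j α).1 :=
          Finset.sum_congr rfl fun j _ => ((el j).sum_comp fun a => d a.1).symm
      _ = ∑ j, l j * d (rep j) := by simp [hdim]
  refine ⟨_, l, fun j => d (rep j), B', fun j => t' (rep j), fun j => ⟨?_, hd _⟩, hB',
    (Matrix.mul_eq_one_comm_of_card_eq _ _ _ hcard').2 hB',
    fun j => hstar (rep j), ?_, ?_, fun j x hx => hirr _ x hx⟩
  · exact Fintype.card_pos_iff.2 ⟨⟨rep j, hrep j⟩⟩
  · intro i s j α x
    have h := hui j α i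
    calc (t i * B') s ⟨j, (α, x)⟩
        = ∑ z, (t i * B) s ⟨(el j α).1, z⟩ * u j α z x := by
          simp only [B', Matrix.mul_apply, Matrix.of_apply, Finset.mul_sum, Finset.sum_mul]
          rw [Finset.sum_comm]
          simp only [mul_assoc]
      _ = ∑ y, B s ⟨(el j α).1, y⟩ * (t' (el j α).1 i * u j α) y x := by
          simp only [hblock, Matrix.mul_apply, Finset.mul_sum, Finset.sum_mul]
          rw [Finset.sum_comm]
          simp only [mul_assoc]
      _ = _ := by
          rw [h]
          simp only [B', Matrix.mul_apply, Matrix.of_apply, Finset.mul_sum, Finset.sum_mul]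
          rw [Finset.sum_comm]
          simp only [mul_assoc]
  · intro j k x hx hjk
    by_contra hne'
    obtain ⟨v, hv⟩ := exists_unitary_intertwiner (hstar _) (hstar _) (hirr _) (hirr _) hx hne'
    refine hjk (e.injective ?_)
    rw [← hrep j, ← hrep k]
    exact Quotient.sound ⟨v, hv⟩

/-! ### Vanishing from zero trace -/

section PosSemidef

variable {m n ι : Type*} [Fintype m] [Fintype n] [Fintype ι]

open scoped MatrixOrder in
theorem exists_eq_conjTranspose_mul_self {A : Matrix n n ℂ} (hA : A.PosSemidef) :
    ∃ Q : Matrix n n ℂ, A = Qᴴ * Q := by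
  classical
  exact CStarAlgebra.nonneg_iff_eq_star_mul_self.mp hA.nonneg

/-- With ρ = Q† Q the trace is the squared Hilbert–Schmidt norm of A Q†. -/
theorem mul_eq_zero_of_trace_eq_zero {ρ : Matrix n n ℂ} (hρ : ρ.PosSemidef) {A : Matrix m n ℂ}
    (h : (A * ρ * Aᴴ).trace = 0) : A * ρ = 0 := by
  obtain ⟨Q, rfl⟩ := exists_eq_conjTranspose_mul_self hρ
  have h' : ((A * Qᴴ) * (A * Qᴴ)ᴴ).trace = 0 := by
    rw [← h]
    simp [Matrix.mul_assoc]
  rw [Matrix.trace_mul_conjTranspose_self_eq_zero_iff] at h'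
  rw [← Matrix.mul_assoc, h', Matrix.zero_mul]

theorem mul_eq_zero_of_sum_trace_eq_zero {ρ : Matrix n n ℂ} (hρ : ρ.PosSemidef)
    {A : ι → Matrix m n ℂ} (h : ∑ i, (A i * ρ * (A i)ᴴ).trace = 0) (i : ι) : A i * ρ = 0 := by
  refine mul_eq_zero_of_trace_eq_zero hρ ?_
  exact (Finset.sum_eq_zero_iff_of_nonneg fun j _ =>
    (hρ.mul_mul_conjTranspose_same (A j)).trace_nonneg).1 h i (Finset.mem_univ i)

end PosSemidef

/-! ### Kraus operators -/

section Kraus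

variable {ι κ : Type*} [Fintype ι] [DecidableEq ι] [Fintype κ]

/-- The **Kraus representation** of a completely positive map. -/
theorem IsCP.exists_kraus {Φ : Matrix ι ι ℂ →ₗ[ℂ] Matrix κ κ ℂ} (hΦ : IsCP Φ) :
    ∃ M : Fin (Fintype.card ι) × κ → Matrix κ ι ℂ, ∀ X, Φ X = ∑ m, M m * X * (M m)ᴴ := by
  classical
  let e := Fintype.equivFin ι
  -- The unnormalised maximally entangled vector: `idTensor` of its projector is the Choi matrix,
  -- and the conjugated rows of a factor `Q` are the Kraus operators.
  let w : Fin (Fintype.card ι) × ι → ℂ := fun p => if p.1 = e p.2 then 1 else 0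
  obtain ⟨Q, hQ⟩ := exists_eq_conjTranspose_mul_self
    (hΦ _ _ (Matrix.posSemidef_vecMulVec_self_star w))
  have hentry : ∀ s s' a b, Φ (Matrix.single s s' 1) a b =
      ∑ m, star (Q m (e s, a)) * Q m (e s', b) := by
    intro s s' a b
    have h := congrFun (congrFun hQ (e s, a)) (e s', b)
    rw [Matrix.mul_apply] at h
    refine Eq.trans ?_ h
    simp only [idTensor, Matrix.of_apply]
    refine congrArg (fun Z => Φ Z a b) ?_
    ext x y
    by_cases hx : s = x <;> by_cases hy : s' = y <;>
      simp [Matrix.vecMulVec_apply, w, hx, hy]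
  refine ⟨fun m => Matrix.of fun a s => star (Q m (e s, a)), fun X => ?_⟩
  ext a b
  conv_lhs => rw [Matrix.matrix_eq_sum_single X]
  have hsingle : ∀ s s', Matrix.single s s' (X s s') = X s s' • Matrix.single s s' (1 : ℂ) :=
    fun s s' => by rw [Matrix.smul_single, smul_eq_mul, mul_one]
  simp only [hsingle, map_sum, map_smul, Matrix.sum_apply, Matrix.smul_apply, hentry, smul_eq_mul,
    Matrix.mul_apply, Matrix.conjTranspose_apply, Matrix.of_apply, star_star, Finset.mul_sum,
    Finset.sum_mul]
  conv_rhs => rw [Finset.sum_comm]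
  rw [Finset.sum_comm]
  refine Fintype.sum_congr _ _ fun s' => ?_
  rw [Finset.sum_comm]
  refine Fintype.sum_congr _ _ fun m => Fintype.sum_congr _ _ fun s => ?_
  ring

theorem sum_conjTranspose_mul_self_eq_one {μ : Type*} [Fintype μ] {M : μ → Matrix κ ι ℂ}
    (h : ∀ X : Matrix ι ι ℂ, (∑ m, M m * X * (M m)ᴴ).trace = X.trace) : ∑ m, (M m)ᴴ * M m = 1 := by
  rw [Matrix.ext_iff_trace_mul_right]
  intro X
  rw [Matrix.one_mul, ← h X, Matrix.sum_mul, Matrix.trace_sum, Matrix.trace_sum]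
  refine Fintype.sum_congr _ _ fun m => ?_
  rw [Matrix.mul_assoc, Matrix.trace_mul_comm]

end Kraus

/-- The orthogonal projection onto the sum of the ranges of the matrices in `R`. -/
theorem exists_support_projection {S : Type*} [Fintype S] [DecidableEq S]
    (R : Set (Matrix S S ℂ)) :
    ∃ P : Matrix S S ℂ, Pᴴ = P ∧ P * P = P ∧ (∀ ρ ∈ R, P * ρ = ρ) ∧
      ∀ Z : Matrix S S ℂ, (∀ ρ ∈ R, Z * ρ = 0) → Z * P = 0 := by
  let U : Submodule ℂ (EuclideanSpace ℂ S) := ⨆ ρ : R, LinearMap.range ρ.1.toEuclideanLin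
  let P : Matrix S S ℂ := (Matrix.toEuclideanCLM (n := S) (𝕜 := ℂ)).symm U.starProjection
  have hP : Matrix.toEuclideanCLM (n := S) (𝕜 := ℂ) P = U.starProjection :=
    (Matrix.toEuclideanCLM (n := S) (𝕜 := ℂ)).apply_symm_apply _
  have hPv : ∀ v : S → ℂ, U.starProjection (WithLp.toLp 2 v) = WithLp.toLp 2 (P *ᵥ v) := fun v => by
    rw [← hP, Matrix.toEuclideanCLM_toLp]
  refine ⟨P, ?_, ?_, ?_, ?_⟩
  · apply (EquivLike.injective (Matrix.toEuclideanCLM (n := S) (𝕜 := ℂ)))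
    rw [← Matrix.star_eq_conjTranspose, map_star, hP]
    exact isSelfAdjoint_starProjection U
  · apply (EquivLike.injective (Matrix.toEuclideanCLM (n := S) (𝕜 := ℂ)))
    rw [map_mul, hP]
    exact U.isIdempotentElem_starProjection
  · intro ρ hρ
    refine Matrix.ext_of_mulVec_single fun s => ?_
    rw [← Matrix.mulVec_mulVec]
    apply WithLp.toLp_injective 2
    rw [← hPv, Submodule.starProjection_eq_self_iff]
    exact Submodule.mem_iSup_of_mem ⟨ρ, hρ⟩
      ⟨WithLp.toLp 2 (Pi.single s 1), by simp [Matrix.toLpLin_apply]⟩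
  · intro Z hZ
    have hU : U ≤ LinearMap.ker Z.toEuclideanLin := by
      refine iSup_le fun ρ => ?_
      rintro _ ⟨v, rfl⟩
      simp [Matrix.toLpLin_apply, Matrix.mulVec_mulVec, hZ _ ρ.2]
    refine Matrix.ext_of_mulVec_single fun s => ?_
    rw [← Matrix.mulVec_mulVec]
    have := hU (U.starProjection_apply_mem (WithLp.toLp 2 (Pi.single s 1)))
    rw [hPv, LinearMap.mem_ker, Matrix.toLpLin_toLp, Matrix.toLin'_apply] at this
    rw [(WithLp.toLp_eq_zero 2).1 this, Matrix.zero_mulVec]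

/-! ### Invariant states and fixed points of the dual map -/

section FixedPoints

variable {S μ : Type*} [Fintype S] [Fintype μ]

/-- By invariance, the traces of (1 - P) K i ρ (K i)† (1 - P) sum to that of (1 - P) ρ (1 - P),
which is zero; so each (1 - P) K i kills every ρ in `R`, hence P. -/
theorem projection_mul_kraus [DecidableEq S] {R : Set (Matrix S S ℂ)} {P : Matrix S S ℂ}
    {K : μ → Matrix S S ℂ}
    (hPR : ∀ ρ ∈ R, P * ρ = ρ) (hZ : ∀ Z : Matrix S S ℂ, (∀ ρ ∈ R, Z * ρ = 0) → Z * P = 0)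
    (hR : ∀ ρ ∈ R, ρ.PosSemidef) (hfix : ∀ ρ ∈ R, ∑ i, K i * ρ * (K i)ᴴ = ρ) (i : μ) :
    P * (K i * P) = K i * P := by
  have h : (1 - P) * K i * P = 0 := by
    refine hZ _ fun ρ hρ => ?_
    refine mul_eq_zero_of_sum_trace_eq_zero (A := fun i => (1 - P) * K i) (hR ρ hρ) ?_ i
    have : ∑ i, ((1 - P) * K i * ρ * ((1 - P) * K i)ᴴ) = (1 - P) * ρ * (1 - P)ᴴ := by
      conv_rhs => rw [← hfix ρ hρ]
      simp only [Matrix.mul_sum, Matrix.sum_mul, Matrix.conjTranspose_mul, Matrix.mul_assoc]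
    rw [← Matrix.trace_sum, this, Matrix.sub_mul, Matrix.one_mul, hPR ρ hρ, sub_self,
      Matrix.zero_mul, Matrix.trace_zero]
  rw [Matrix.sub_mul, Matrix.one_mul, Matrix.sub_mul, sub_eq_zero, Matrix.mul_assoc] at h
  exact h.symm

/-- A fixed point of the dual of a completely positive map with Kraus operators `L i` commutes
with all `L i`, provided that the map preserves the trace and has enough invariant states `R` on
the range of `P`. -/
theorem commute_kraus_of_dual_fixed {R : Set (Matrix S S ℂ)} {P : Matrix S S ℂ}
    {L : μ → Matrix S S ℂ} (hP : Pᴴ = P)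
    (hZ : ∀ Z : Matrix S S ℂ, (∀ ρ ∈ R, Z * ρ = 0) → Z * P = 0)
    (hR : ∀ ρ ∈ R, ρ.PosSemidef) (hfix : ∀ ρ ∈ R, ∑ i, L i * ρ * (L i)ᴴ = ρ)
    (hLP : ∀ i, L i * P = L i) (hsum : ∑ i, (L i)ᴴ * L i = P) {Y : Matrix S S ℂ}
    (hY : ∑ i, (L i)ᴴ * Y * L i = Y) (i : μ) : L i * Y = Y * L i := by
  have hPL : ∀ i, P * (L i)ᴴ = (L i)ᴴ := fun i => by
    conv_rhs => rw [← hLP i, Matrix.conjTranspose_mul, hP]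
  have hPY : P * Y = Y := by
    conv_lhs => rw [← hY]
    conv_rhs => rw [← hY]
    simp only [Matrix.mul_sum, ← Matrix.mul_assoc, hPL]
  have hYP : Y * P = Y := by
    conv_lhs => rw [← hY]
    conv_rhs => rw [← hY]
    simp only [Matrix.sum_mul, Matrix.mul_assoc, hLP]
  have hYH : ∑ i, (L i)ᴴ * Yᴴ * L i = Yᴴ := by
    conv_rhs => rw [← hY]
    simp [Matrix.conjTranspose_sum, Matrix.mul_assoc]
  have h : (L i * Y - Y * L i) * P = 0 := by
    refine hZ _ fun ρ hρ => ?_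
    refine mul_eq_zero_of_sum_trace_eq_zero (A := fun i => L i * Y - Y * L i) (hR ρ hρ) ?_ i
    -- Each of the four terms in the expansion of [L, Y] ρ [L, Y]†, summed over i, has trace tr (Y ρ
    -- Y†), so they cancel.
    have h1 : ∑ i, (L i * Y * ρ * (Yᴴ * (L i)ᴴ)).trace = (Y * ρ * Yᴴ).trace := by
      calc ∑ i, (L i * Y * ρ * (Yᴴ * (L i)ᴴ)).trace
          = ∑ i, ((L i)ᴴ * L i * (Y * ρ * Yᴴ)).trace := by
            refine Fintype.sum_congr _ _ fun i => ?_
            rw [← Matrix.mul_assoc, Matrix.trace_mul_comm]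
            simp only [Matrix.mul_assoc]
        _ = (Y * ρ * Yᴴ).trace := by
            rw [← Matrix.trace_sum, ← Matrix.sum_mul, hsum]
            simp only [← Matrix.mul_assoc, hPY]
    have h2 : ∑ i, (L i * Y * ρ * ((L i)ᴴ * Yᴴ)).trace = (Y * ρ * Yᴴ).trace := by
      conv_rhs => rw [← hYH]
      simp only [Matrix.mul_sum, Matrix.trace_sum]
      refine Fintype.sum_congr _ _ fun i => ?_
      simp only [Matrix.mul_assoc]
      rw [Matrix.trace_mul_comm]
      simp only [Matrix.mul_assoc]
    have h3 : ∑ i, (Y * L i * ρ * (Yᴴ * (L i)ᴴ)).trace = (Y * ρ * Yᴴ).trace := by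
      calc ∑ i, (Y * L i * ρ * (Yᴴ * (L i)ᴴ)).trace
          = ∑ i, ((L i)ᴴ * Y * L i * (ρ * Yᴴ)).trace := by
            refine Fintype.sum_congr _ _ fun i => ?_
            rw [← Matrix.mul_assoc, Matrix.trace_mul_comm]
            simp only [Matrix.mul_assoc]
        _ = (Y * ρ * Yᴴ).trace := by
            rw [← Matrix.trace_sum, ← Matrix.sum_mul, hY, Matrix.mul_assoc]
    have h4 : ∑ i, (Y * L i * ρ * ((L i)ᴴ * Yᴴ)).trace = (Y * ρ * Yᴴ).trace := by
      conv_rhs => rw [← hfix ρ hρ]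
      simp only [Matrix.mul_sum, Matrix.sum_mul, Matrix.trace_sum, Matrix.mul_assoc]
    simp only [Matrix.conjTranspose_sub, Matrix.conjTranspose_mul, Matrix.sub_mul, Matrix.mul_sub,
      Matrix.trace_sub, Finset.sum_sub_distrib, h1, h2, h3, h4, sub_self]
  rwa [Matrix.sub_mul, Matrix.mul_assoc, hYP, Matrix.mul_assoc, hLP, sub_eq_zero] at h

/-- Rank–nullity for a square matrix and its adjoint. It bounds the fixed points of a map by those
of its dual. -/
theorem finrank_ker_conjTranspose (A : Matrix S S ℂ) :
    Module.finrank ℂ (LinearMap.ker Aᴴ.mulVecLin) = Module.finrank ℂ (LinearMap.ker A.mulVecLin) := by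
  have h1 := LinearMap.finrank_range_add_finrank_ker A.mulVecLin
  have h2 := LinearMap.finrank_range_add_finrank_ker Aᴴ.mulVecLin
  have h3 := Matrix.rank_conjTranspose A
  rw [Matrix.rank, Matrix.rank] at h3
  omega

end FixedPoints

/-! ### Fixed points of a map and of its dual between blocks -/

section Slice

variable {α β μ : Type*} [Fintype μ]

/-- The matrix of the map `x ↦ ∑ i, f i * x * (g i)ᴴ`. -/
noncomputable def sandwich (f : μ → Matrix α α ℂ) (g : μ → Matrix β β ℂ) :
    Matrix (α × β) (α × β) ℂ :=
  Matrix.of fun p q => ∑ i, f i p.1 q.1 * star (g i p.2 q.2)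

theorem conjTranspose_sandwich (f : μ → Matrix α α ℂ) (g : μ → Matrix β β ℂ) :
    (sandwich f g)ᴴ = sandwich (fun i => (f i)ᴴ) (fun i => (g i)ᴴ) := by
  ext p q
  simp [sandwich, mul_comm]

variable [Fintype α] [Fintype β]

theorem sandwich_mulVec (f : μ → Matrix α α ℂ) (g : μ → Matrix β β ℂ) (x : Matrix α β ℂ) :
    (sandwich f g *ᵥ fun p => x p.1 p.2) = fun p => (∑ i, f i * x * (g i)ᴴ) p.1 p.2 := by
  funext p
  simp only [sandwich, Matrix.mulVec, dotProduct, Matrix.of_apply, Matrix.sum_apply,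
    Matrix.mul_apply, Matrix.conjTranspose_apply, Fintype.sum_prod_type, Finset.sum_mul]
  conv_rhs => rw [Finset.sum_comm]; enter [2, y]; rw [Finset.sum_comm]
  rw [Finset.sum_comm]
  refine Fintype.sum_congr _ _ fun y => Fintype.sum_congr _ _ fun z =>
    Fintype.sum_congr _ _ fun i => ?_
  ring

variable [DecidableEq α] [DecidableEq β]

theorem mem_ker_sandwich_sub_one (f : μ → Matrix α α ℂ) (g : μ → Matrix β β ℂ)
    (x : Matrix α β ℂ) :
    (fun p : α × β => x p.1 p.2) ∈ LinearMap.ker (sandwich f g - 1).mulVecLin ↔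
      ∑ i, f i * x * (g i)ᴴ = x := by
  rw [LinearMap.mem_ker, Matrix.mulVecLin_apply, Matrix.sub_mulVec, Matrix.one_mulVec,
    sandwich_mulVec, sub_eq_zero]
  constructor
  · intro h
    ext a b
    exact congrFun h (a, b)
  · intro h
    rw [h]

/-- The fixed points of `x ↦ ∑ i, f i * x * (g i)ᴴ` vanish if those of the dual map do. -/
theorem eq_zero_of_fixed {f : μ → Matrix α α ℂ} {g : μ → Matrix β β ℂ}
    (h : ∀ y : Matrix α β ℂ, ∑ i, (f i)ᴴ * y * g i = y → y = 0)
    {x : Matrix α β ℂ} (hx : ∑ i, f i * x * (g i)ᴴ = x) : x = 0 := by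
  have h0 : LinearMap.ker (sandwich f g - 1)ᴴ.mulVecLin = ⊥ := by
    rw [eq_bot_iff]
    intro v hv
    rw [Matrix.conjTranspose_sub, conjTranspose_sandwich, Matrix.conjTranspose_one] at hv
    have := h (Matrix.of fun a b => v (a, b))
      (by simpa using (mem_ker_sandwich_sub_one _ _ (Matrix.of fun a b => v (a, b))).1 hv)
    funext p
    exact congrFun (congrFun this p.1) p.2
  have h1 := finrank_ker_conjTranspose (sandwich f g - 1)
  rw [h0, finrank_bot, eq_comm, Submodule.finrank_eq_zero] at h1
  have h2 := (mem_ker_sandwich_sub_one f g x).2 hx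
  rw [h1, Submodule.mem_bot] at h2
  ext a b
  exact congrFun h2 (a, b)

/-- The fixed points of `x ↦ ∑ i, f i * x * (f i)ᴴ` are proportional to a given one of trace `1`
if those of the dual map are scalar. -/
theorem eq_smul_of_fixed {f : μ → Matrix α α ℂ}
    (h : ∀ y : Matrix α α ℂ, ∑ i, (f i)ᴴ * y * f i = y → ∃ c : ℂ, y = c • 1)
    {ω : Matrix α α ℂ} (hω : ∑ i, f i * ω * (f i)ᴴ = ω) (hωt : ω.trace = 1)
    {x : Matrix α α ℂ} (hx : ∑ i, f i * x * (f i)ᴴ = x) : x = x.trace • ω := by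
  -- The dual fixed points lie in the line of scalars, so the fixed points of the map itself also
  -- span at most a line; `ω` is a nonzero element of it.
  have h0 : Module.finrank ℂ (LinearMap.ker (sandwich f f - 1)ᴴ.mulVecLin) ≤ 1 := by
    have hle : LinearMap.ker (sandwich f f - 1)ᴴ.mulVecLin ≤
        Submodule.span ℂ {fun p : α × α => (1 : Matrix α α ℂ) p.1 p.2} := by
      intro v hv
      rw [Matrix.conjTranspose_sub, conjTranspose_sandwich, Matrix.conjTranspose_one] at hv
      obtain ⟨c, hc⟩ := h (Matrix.of fun a b => v (a, b))
        (by simpa using (mem_ker_sandwich_sub_one _ _ (Matrix.of fun a b => v (a, b))).1 hv)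
      refine Submodule.mem_span_singleton.2 ⟨c, ?_⟩
      funext p
      exact (congrFun (congrFun hc p.1) p.2).symm
    refine (Submodule.finrank_mono hle).trans ((finrank_span_le_card _).trans ?_)
    simp
  rw [finrank_ker_conjTranspose, finrank_le_one_iff] at h0
  obtain ⟨v, hv⟩ := h0
  obtain ⟨c, hc⟩ := hv ⟨_, (mem_ker_sandwich_sub_one f f ω).2 hω⟩
  obtain ⟨c', hc'⟩ := hv ⟨_, (mem_ker_sandwich_sub_one f f x).2 hx⟩
  have hωv : ω = c • Matrix.of fun a b => v.1 (a, b) := by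
    ext a b
    exact (congrFun (congrArg Subtype.val hc) (a, b)).symm
  have hxv : x = c' • Matrix.of fun a b => v.1 (a, b) := by
    ext a b
    exact (congrFun (congrArg Subtype.val hc') (a, b)).symm
  rw [hωv, Matrix.trace_smul, smul_eq_mul] at hωt
  rw [hxv, hωv, Matrix.trace_smul, smul_smul, smul_eq_mul]
  congr 1
  rw [mul_assoc, mul_comm _ c, hωt, mul_one]

end Slice

/-! ### Density operators and partial traces -/

section Density

variable {ι : Type*} [Fintype ι]

theorem exists_isDensity [Nonempty ι] : ∃ ρ : Matrix ι ι ℂ, IsDensity ρ := by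
  classical
  obtain ⟨i⟩ := ‹Nonempty ι›
  refine ⟨Matrix.diagonal (Pi.single i 1), Matrix.PosSemidef.diagonal ?_, ?_⟩
  · exact Pi.single_nonneg.2 zero_le_one
  · simp [Matrix.trace_diagonal]

theorem exists_isDensity_smul [Nonempty ι] {Y : Matrix ι ι ℂ} (hY : Y.PosSemidef) :
    ∃ (p : ℝ) (σ : Matrix ι ι ℂ), 0 ≤ p ∧ IsDensity σ ∧ (p : ℂ) = Y.trace ∧ Y = (p : ℂ) • σ := by
  have h0 := Complex.le_def.1 hY.trace_nonneg
  have htr : ((Y.trace.re : ℝ) : ℂ) = Y.trace := Complex.ext rfl (by simpa using h0.2)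
  -- A positive matrix of trace zero is zero, and any density operator with weight 0 serves.
  by_cases hp : Y.trace.re = 0
  · obtain ⟨σ, hσ⟩ := exists_isDensity (ι := ι)
    rw [hp, Complex.ofReal_zero, eq_comm, hY.trace_eq_zero_iff] at htr
    exact ⟨0, σ, le_rfl, hσ, by simp [htr], by simp [htr]⟩
  · have hp' : ((Y.trace.re : ℝ) : ℂ) ≠ 0 := by exact_mod_cast hp
    have h1 : 0 ≤ Y.trace.re := by simpa using h0.1
    refine ⟨Y.trace.re, ((Y.trace.re : ℝ) : ℂ)⁻¹ • Y, h1, ⟨?_, ?_⟩, htr, ?_⟩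
    · refine hY.smul ?_
      rw [← Complex.ofReal_inv]
      exact Complex.zero_le_real.2 (inv_nonneg.2 h1)
    · rw [Matrix.trace_smul, htr, smul_eq_mul, inv_mul_cancel₀ (htr ▸ hp')]
    · rw [smul_smul, mul_inv_cancel₀ hp', one_smul]

end Density

section PartialTrace

variable {σ ε : Type*} [Fintype ε]

theorem partialTrace_apply (X : Matrix (σ × ε) (σ × ε) ℂ) (a b : σ) :
    partialTrace X a b = ∑ i, X (a, i) (b, i) := rfl

theorem partialTrace_eq_sum (X : Matrix (σ × ε) (σ × ε) ℂ) :
    partialTrace X = ∑ i, X.submatrix (fun a => (a, i)) fun a => (a, i) := by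
  ext a b
  simp [partialTrace_apply, Matrix.sum_apply]

theorem _root_.Matrix.PosSemidef.partialTrace {X : Matrix (σ × ε) (σ × ε) ℂ}
    (hX : X.PosSemidef) : (ReducedDynamics.partialTrace X).PosSemidef := by
  rw [partialTrace_eq_sum]
  exact Matrix.posSemidef_sum _ fun i _ => hX.submatrix _

theorem trace_partialTrace [Fintype σ] (X : Matrix (σ × ε) (σ × ε) ℂ) :
    (partialTrace X).trace = X.trace := by
  simp [Matrix.trace, partialTrace_apply, Fintype.sum_prod_type]

end PartialTrace

/-! ### Block structure of invariant states -/

/-- Simultaneous block structure of the states `R` invariant under a trace-preserving completely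
positive map, and of the images of these states under its Kraus operators. -/
theorem exists_invariant_block_structure {S E μ : Type*} [Fintype S] [DecidableEq S] [Fintype E]
    [Fintype μ] (hE : Nonempty S → Nonempty E) (K : μ × E → Matrix S S ℂ)
    (hK : ∑ i, (K i)ᴴ * K i = 1) (R : Set (Matrix S S ℂ)) (hR : ∀ ρ ∈ R, ρ.PosSemidef)
    (hfix : ∀ ρ ∈ R, ∑ i, K i * ρ * (K i)ᴴ = ρ) :
    ∃ (n : ℕ) (l r : Fin n → ℕ) (B : Matrix S (Σ j, Fin (l j) × Fin (r j)) ℂ)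
      (ω : ∀ j, Matrix (Fin (r j) × E) (Fin (r j) × E) ℂ),
      (∀ j, 0 < l j ∧ 0 < r j) ∧ Bᴴ * B = 1 ∧ B * Bᴴ = 1 ∧ (∀ j, IsDensity (ω j)) ∧
      (∀ ρ ∈ R, ∀ e e' j k, j ≠ k → ∀ α x β y,
        (Bᴴ * (∑ m, K (m, e) * ρ * (K (m, e'))ᴴ) * B) ⟨j, (α, x)⟩ ⟨k, (β, y)⟩ = 0) ∧
      ∀ ρ ∈ R, ∀ e e' j α x β y,
        (Bᴴ * (∑ m, K (m, e) * ρ * (K (m, e'))ᴴ) * B) ⟨j, (α, x)⟩ ⟨j, (β, y)⟩ =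
          (∑ z, (Bᴴ * ρ * B) ⟨j, (α, z)⟩ ⟨j, (β, z)⟩) * ω j (x, e) (y, e') := by
  classical
  obtain ⟨P, hP, hPP, hPR, hZ⟩ := exists_support_projection R
  have hPK := projection_mul_kraus hPR hZ hR hfix
  have hRP : ∀ ρ ∈ R, ρ * P = ρ := fun ρ hρ => by
    have := congrArg Matrix.conjTranspose (hPR ρ hρ)
    rwa [Matrix.conjTranspose_mul, hP, (hR ρ hρ).1.eq] at this
  -- Cutting down to the joint support leaves the action on `R` unchanged, and there vanishing on
  -- all states of `R` forces an operator to be zero.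
  let L : μ × E → Matrix S S ℂ := fun i => K i * P
  have hLP : ∀ i, L i * P = L i := fun i => by simp only [L, Matrix.mul_assoc, hPP]
  have hLρ : ∀ ρ ∈ R, ∀ i i', L i * ρ * (L i')ᴴ = K i * ρ * (K i')ᴴ := fun ρ hρ i i' => by
    simp only [L, Matrix.conjTranspose_mul, hP]
    rw [Matrix.mul_assoc (K i), hPR ρ hρ, ← Matrix.mul_assoc, Matrix.mul_assoc (K i), hRP ρ hρ]
  have hLsum : ∑ i, (L i)ᴴ * L i = P := by
    calc ∑ i, (L i)ᴴ * L i = P * (∑ i, (K i)ᴴ * K i) * P := by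
          simp only [L, Matrix.conjTranspose_mul, hP, Matrix.mul_sum, Matrix.sum_mul,
            Matrix.mul_assoc]
      _ = P := by rw [hK, Matrix.mul_one, hPP]
  have hLfix : ∀ ρ ∈ R, ∑ i, L i * ρ * (L i)ᴴ = ρ := fun ρ hρ => by
    simp only [hLρ ρ hρ, hfix ρ hρ]
  -- The family consists of the `L i` and their adjoints, with `Sum.swap` as the adjoint operation.
  obtain ⟨n, l, r, B, t', hpos, hBB, hBB', hstar, hblock, hdisj, hscal⟩ :=
    exists_isotypic_decomposition (Sum.elim L fun i => (L i)ᴴ) Sum.swap (by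
      rintro (i | i) <;> simp)
  let C : ∀ j, Fin (l j) → Matrix S (Fin (r j)) ℂ := fun j α =>
    B.submatrix id fun x => ⟨j, (α, x)⟩
  have hC : ∀ i j α, (Sum.elim L fun i => (L i)ᴴ) i * C j α = C j α * t' j i := by
    intro i j α
    ext s x
    exact hblock i s j α x
  let f : ∀ j, μ × E → Matrix (Fin (r j)) (Fin (r j)) ℂ := fun j i => t' j (Sum.inl i)
  have hLC : ∀ i j α, L i * C j α = C j α * f j i := fun i => hC (Sum.inl i)
  have hLC' : ∀ i j α, (L i)ᴴ * C j α = C j α * (f j i)ᴴ := fun i j α => by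
    rw [← hstar]
    exact hC (Sum.inr i) j α
  have hCL : ∀ i j α, (C j α)ᴴ * L i = f j i * (C j α)ᴴ := fun i j α => by
    simpa using congrArg Matrix.conjTranspose (hLC' i j α)
  have hCL' : ∀ i j α, (C j α)ᴴ * (L i)ᴴ = (f j i)ᴴ * (C j α)ᴴ := fun i j α => by
    simpa using congrArg Matrix.conjTranspose (hLC i j α)
  have hCC : ∀ j α, (C j α)ᴴ * C j α = 1 := by
    intro j α
    ext x y
    have := congrFun (congrFun hBB ⟨j, (α, x)⟩) ⟨j, (α, y)⟩
    rw [Matrix.mul_apply] at this ⊢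
    refine this.trans ?_
    simp [Matrix.one_apply]
  have hblk : ∀ (X : Matrix S S ℂ) j k α β x y, (Bᴴ * X * B) ⟨j, (α, x)⟩ ⟨k, (β, y)⟩ =
      ((C j α)ᴴ * X * C k β) x y := fun X j k α β x y => by
    simp [Matrix.mul_apply, C]
  have hsand : ∀ (X : Matrix S S ℂ) i i' j k α β, (C j α)ᴴ * (L i * X * (L i')ᴴ) * C k β =
      f j i * ((C j α)ᴴ * X * C k β) * (f k i')ᴴ := fun X i i' j k α β => by
    simp only [← Matrix.mul_assoc, hCL]
    simp only [Matrix.mul_assoc, hLC']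
  have hfixblk : ∀ ρ ∈ R, ∀ j k α β,
      ∑ i, f j i * ((C j α)ᴴ * ρ * C k β) * (f k i)ᴴ = (C j α)ᴴ * ρ * C k β := by
    intro ρ hρ j k α β
    conv_rhs => rw [← hLfix ρ hρ]
    simp only [← hsand, Matrix.mul_sum, Matrix.sum_mul]
  -- A dual fixed point y between blocks lifts to C y C†, a dual fixed point on the whole space. It
  -- commutes with all L, and through its adjoint with all L†; compressing back makes y an
  -- intertwiner.
  have hdual : ∀ j k (y : Matrix (Fin (r j)) (Fin (r k)) ℂ),
      ∑ i, (f j i)ᴴ * y * f k i = y → Intertwines (t' j) (t' k) y := by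
    intro j k y hy
    let α : Fin (l j) := ⟨0, (hpos j).1⟩
    let β : Fin (l k) := ⟨0, (hpos k).1⟩
    have hY : ∑ i, (L i)ᴴ * (C j α * y * (C k β)ᴴ) * L i = C j α * y * (C k β)ᴴ := by
      conv_rhs => rw [← hy]
      simp only [Matrix.mul_sum, Matrix.sum_mul]
      refine Fintype.sum_congr _ _ fun i => ?_
      simp only [← Matrix.mul_assoc, hLC']
      simp only [Matrix.mul_assoc, hCL]
    have hYH : ∑ i, (L i)ᴴ * (C j α * y * (C k β)ᴴ)ᴴ * L i = (C j α * y * (C k β)ᴴ)ᴴ := by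
      conv_rhs => rw [← hY]
      simp [Matrix.conjTranspose_sum, Matrix.mul_assoc]
    have hcomm : ∀ i, (Sum.elim L fun i => (L i)ᴴ) i * (C j α * y * (C k β)ᴴ) =
        C j α * y * (C k β)ᴴ * (Sum.elim L fun i => (L i)ᴴ) i := by
      rintro (i | i)
      · exact commute_kraus_of_dual_fixed hP hZ hR hLfix hLP hLsum hY i
      · have := commute_kraus_of_dual_fixed hP hZ hR hLfix hLP hLsum hYH i
        simpa [Matrix.mul_assoc] using (congrArg Matrix.conjTranspose this).symm
    intro i
    have := congrArg (fun Z => (C j α)ᴴ * Z * C k β) (hcomm i)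
    simp only [← Matrix.mul_assoc] at this
    rw [Matrix.mul_assoc _ (Sum.elim L _ i) (C j α), hC, ← Matrix.mul_assoc, hCC,
      Matrix.one_mul, Matrix.mul_assoc _ (C k β)ᴴ, hCC, Matrix.mul_one, Matrix.one_mul,
      Matrix.mul_assoc _ (Sum.elim L _ i), hC, Matrix.mul_assoc _ (C k β)ᴴ,
      ← Matrix.mul_assoc (C k β)ᴴ, hCC, Matrix.one_mul] at this
    exact this
  have hω : ∀ j, ∃ ω : Matrix (Fin (r j) × E) (Fin (r j) × E) ℂ, IsDensity ω ∧
      ∀ ρ ∈ R, ∀ e e' α β x y,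
        (∑ m, f j (m, e) * ((C j α)ᴴ * ρ * C j β) * (f j (m, e'))ᴴ) x y =
          ((C j α)ᴴ * ρ * C j β).trace * ω (x, e) (y, e') := by
    intro j
    have hr : Nonempty (Fin (r j)) := ⟨⟨0, (hpos j).2⟩⟩
    have hS : Nonempty S := by
      by_contra hS
      rw [not_nonempty_iff] at hS
      have := congrFun (congrFun (hCC j ⟨0, (hpos j).1⟩) hr.some) hr.some
      simp [Matrix.mul_apply] at this
    have hE' := hE hS
    by_cases hex : ∃ ω : Matrix (Fin (r j)) (Fin (r j)) ℂ, IsDensity ω ∧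
        ∑ i, f j i * ω * (f j i)ᴴ = ω
    · obtain ⟨ω, hωd, hωf⟩ := hex
      -- Stacking the slices over e gives Kraus operators into r_j ⊗ E, so the environment is not
      -- yet traced out.
      let N : μ → Matrix (Fin (r j) × E) (Fin (r j)) ℂ := fun m =>
        Matrix.of fun p x => f j (m, p.2) p.1 x
      have hN : ∀ x e y e', (∑ m, N m * ω * (N m)ᴴ) (x, e) (y, e') =
          (∑ m, f j (m, e) * ω * (f j (m, e'))ᴴ) x y := by
        intro x e y e'
        simp [N, Matrix.sum_apply, Matrix.mul_apply]
      refine ⟨∑ m, N m * ω * (N m)ᴴ, ⟨?_, ?_⟩, ?_⟩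
      · exact Matrix.posSemidef_sum _ fun m _ => hωd.1.mul_mul_conjTranspose_same _
      · rw [← hωd.2]
        conv_rhs => rw [← hωf, Fintype.sum_prod_type_right]
        simp only [Matrix.trace, Matrix.diag_apply, Fintype.sum_prod_type, hN, Matrix.sum_apply]
      · intro ρ hρ e e' α β x y
        have h1 := eq_smul_of_fixed (fun y hy => hscal j y (hdual j j y hy)) hωf hωd.2
          (hfixblk ρ hρ j j α β)
        rw [hN]
        conv_lhs => rw [h1]
        simp only [Matrix.mul_smul, Matrix.smul_mul, ← Finset.smul_sum, Matrix.smul_apply,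
          smul_eq_mul]
    -- Without an invariant density operator, no state of `R` meets the block, since a nonzero
    -- diagonal block could be normalised to one. Then ω_j is arbitrary; its existence needs `E`
    -- nonempty.
    · obtain ⟨ω, hω⟩ := exists_isDensity (ι := Fin (r j) × E)
      refine ⟨ω, hω, fun ρ hρ e e' α β x y => ?_⟩
      have hz : (C j α)ᴴ * ρ = 0 := by
        have hpsd : ((C j α)ᴴ * ρ * C j α).PosSemidef :=
          (hR ρ hρ).conjTranspose_mul_mul_same (C j α)
        obtain ⟨p, σ, -, hσ, hp, hpσ⟩ := exists_isDensity_smul hpsd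
        refine mul_eq_zero_of_trace_eq_zero (hR ρ hρ) ?_
        rw [Matrix.conjTranspose_conjTranspose, ← hp]
        by_contra hp0
        refine hex ⟨σ, hσ, ?_⟩
        have h1 := hfixblk ρ hρ j j α α
        rw [hpσ] at h1
        simp only [Matrix.mul_smul, Matrix.smul_mul, ← Finset.smul_sum] at h1
        exact smul_right_injective _ hp0 h1
      simp [hz]
  choose ω hωd hω using hω
  refine ⟨n, l, r, B, ω, hpos, hBB, hBB', hωd, ?_, ?_⟩
  · intro ρ hρ e e' j k hjk α x β y
    have h1 : (C j α)ᴴ * ρ * C k β = 0 :=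
      eq_zero_of_fixed (fun y hy => hdisj j k y (hdual j k y hy) hjk) (hfixblk ρ hρ j k α β)
    rw [hblk]
    simp only [Matrix.mul_sum, Matrix.sum_mul, ← hLρ ρ hρ, hsand, h1]
    simp
  · intro ρ hρ e e' j α x β y
    rw [hblk]
    simp only [hblk]
    refine Eq.trans ?_ (hω j ρ hρ e e' α β x y)
    simp only [Matrix.mul_sum, Matrix.sum_mul, ← hLρ ρ hρ, hsand]

/-! ### Entries of block states and local conjugation -/

section BlockState

variable {n : ℕ} {l r : Fin n → ℕ} {E : Type*}

theorem blockState_apply_eq (p : Fin n → ℝ) (σ : ∀ j, Matrix (Fin (l j)) (Fin (l j)) ℂ)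
    (ω : ∀ j, Matrix (Fin (r j) × E) (Fin (r j) × E) ℂ) (j : Fin n) (α β x y) (e e' : E) :
    blockState p σ ω (⟨j, (α, x)⟩, e) (⟨j, (β, y)⟩, e') =
      p j * (σ j α β * ω j (x, e) (y, e')) :=
  Matrix.blockDiagonal'_apply_eq (fun j => (p j : ℂ) • (σ j ⊗ₖ ω j)) j (α, (x, e)) (β, (y, e'))

theorem blockState_apply_ne (p : Fin n → ℝ) (σ : ∀ j, Matrix (Fin (l j)) (Fin (l j)) ℂ)
    (ω : ∀ j, Matrix (Fin (r j) × E) (Fin (r j) × E) ℂ) {j k : Fin n} (hjk : j ≠ k)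
    (α x β y) (e e' : E) :
    blockState p σ ω (⟨j, (α, x)⟩, e) (⟨k, (β, y)⟩, e') = 0 :=
  Matrix.blockDiagonal'_apply_ne (fun j => (p j : ℂ) • (σ j ⊗ₖ ω j)) (α, (x, e)) (β, (y, e')) hjk

end BlockState

section LocalConjugation

variable {S T E : Type*} [Fintype S] [Fintype E] [DecidableEq E]

theorem kronecker_one_conj_apply (V : Matrix T S ℂ) (X : Matrix (S × E) (S × E) ℂ)
    (a b : T) (e e' : E) :
    ((V ⊗ₖ (1 : Matrix E E ℂ)) * X * (V ⊗ₖ (1 : Matrix E E ℂ))ᴴ) (a, e) (b, e') =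
      (V * (X.submatrix (fun s => (s, e)) fun s => (s, e')) * Vᴴ) a b := by
  simp [Matrix.mul_apply, Fintype.sum_prod_type, Matrix.one_apply, apply_ite]

theorem partialTrace_kronecker_one_conj (V : Matrix T S ℂ) (X : Matrix (S × E) (S × E) ℂ) :
    partialTrace ((V ⊗ₖ (1 : Matrix E E ℂ)) * X * (V ⊗ₖ (1 : Matrix E E ℂ))ᴴ) =
      V * partialTrace X * Vᴴ := by
  ext a b
  simp only [partialTrace_apply, kronecker_one_conj_apply, partialTrace_eq_sum, Matrix.mul_sum,
    Matrix.sum_mul, Matrix.sum_apply]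

end LocalConjugation

/-! ### From a channel inverting the partial trace to block form -/

/-- A set of states on which a quantum operation inverts the partial trace is in block form. -/
theorem hasBlockForm_of_isQuantumOperation {S E : Type*} [Fintype S] [Fintype E] [DecidableEq S]
    [DecidableEq E] {D : Set (Matrix (S × E) (S × E) ℂ)} (hstates : ∀ ρ ∈ D, IsDensity ρ)
    {Φ : Matrix S S ℂ →ₗ[ℂ] Matrix (S × E) (S × E) ℂ} (hΦ : IsQuantumOperation Φ)
    (h : ∀ ρ ∈ D, Φ (partialTrace ρ) = ρ) : HasBlockForm D := by
  obtain ⟨M, hM⟩ := hΦ.1.exists_kraus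
  -- Fixing the environment index of the output cuts each Kraus operator of Φ into Kraus operators
  -- of tr_e ∘ Φ.
  let K : (Fin (Fintype.card S) × (S × E)) × E → Matrix S S ℂ := fun i =>
    Matrix.of fun s s' => M i.1 (s, i.2) s'
  have hK : ∀ X e e', (Φ X).submatrix (fun s => (s, e)) (fun s => (s, e')) =
      ∑ m, K (m, e) * X * (K (m, e'))ᴴ := by
    intro X e e'
    ext s s'
    simp [hM, K, Matrix.sum_apply, Matrix.mul_apply]
  have hptr : ∀ X, ∑ i, K i * X * (K i)ᴴ = partialTrace (Φ X) := fun X => by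
    simp only [partialTrace_eq_sum, hK, Fintype.sum_prod_type_right]
  have hE : Nonempty S → Nonempty E := by
    intro hS
    by_contra hE
    rw [not_nonempty_iff] at hE
    have := hΦ.2 1
    rw [Matrix.trace_one, Matrix.trace, Finset.univ_eq_empty, Finset.sum_empty] at this
    exact Fintype.card_ne_zero (α := S) (by exact_mod_cast this.symm)
  obtain ⟨n, l, r, B, ω, hpos, hBB, hBB', hω, hne, heq⟩ :=
    exists_invariant_block_structure hE K
      (sum_conjTranspose_mul_self_eq_one fun X => by rw [hptr, trace_partialTrace, hΦ.2])
      (reducedStates D)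
      (by rintro _ ⟨ρ, hρ, rfl⟩; exact (hstates ρ hρ).1.partialTrace)
      (by rintro _ ⟨ρ, hρ, rfl⟩; rw [hptr, h ρ hρ])
  refine ⟨n, l, r, Bᴴ, ω, hpos, ⟨by simpa using hBB', by simpa using hBB⟩, hω, ?_⟩
  intro ρ hρ
  have hl : ∀ j, Nonempty (Fin (l j)) := fun j => ⟨⟨0, (hpos j).1⟩⟩
  have hpsd : (Bᴴ * partialTrace ρ * B).PosSemidef :=
    (hstates ρ hρ).1.partialTrace.conjTranspose_mul_mul_same B
  -- The operator p_j σ_j is the r_j-trace of the j-th diagonal block of the rotated reduced state.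
  have hY := fun j => exists_isDensity_smul (Matrix.PosSemidef.partialTrace
    (hpsd.submatrix fun p : Fin (l j) × Fin (r j) => (⟨j, p⟩ : Σ j, Fin (l j) × Fin (r j))))
  choose p σ hp hσ htr hYσ using hY
  refine ⟨p, σ, hp, ?_, hσ, ?_⟩
  · have h1 : ∑ j, (p j : ℂ) = 1 := by
      have h2 : (Bᴴ * partialTrace ρ * B).trace = 1 := by
        rw [Matrix.trace_mul_comm, ← Matrix.mul_assoc, hBB', Matrix.one_mul, trace_partialTrace,
          (hstates ρ hρ).2]
      rw [← h2]
      simp only [htr, trace_partialTrace]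
      simp [Matrix.trace, Fintype.sum_sigma]
    exact_mod_cast h1
  · ext ⟨⟨j, α, x⟩, e⟩ ⟨⟨k, β, y⟩, e'⟩
    rw [kronecker_one_conj_apply, Matrix.conjTranspose_conjTranspose]
    have h1 := hK (partialTrace ρ) e e'
    rw [h ρ hρ] at h1
    rw [h1]
    by_cases hjk : j = k
    · subst hjk
      rw [heq _ ⟨ρ, hρ, rfl⟩, blockState_apply_eq, ← mul_assoc]
      congr 1
      exact congrFun (congrFun (hYσ j) α) β
    · rw [hne _ ⟨ρ, hρ, rfl⟩ _ _ _ _ hjk, blockState_apply_ne _ _ _ hjk]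

/-! ### Composition, partial trace and conjugation as channels -/

section Operations

variable {ι κ ν : Type*}

theorem IsQuantumOperation.comp [Fintype ι] [Fintype κ] [Fintype ν]
    {Ψ : Matrix κ κ ℂ →ₗ[ℂ] Matrix ν ν ℂ} {Φ : Matrix ι ι ℂ →ₗ[ℂ] Matrix κ κ ℂ}
    (hΨ : IsQuantumOperation Ψ) (hΦ : IsQuantumOperation Φ) : IsQuantumOperation (Ψ ∘ₗ Φ) :=
  ⟨fun n X hX => hΨ.1 n _ (hΦ.1 n X hX), fun X => (hΨ.2 _).trans (hΦ.2 X)⟩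

theorem isQuantumOperation_partialTrace [Fintype ι] [Fintype κ] :
    IsQuantumOperation (partialTrace : Matrix (ι × κ) (ι × κ) ℂ →ₗ[ℂ] Matrix ι ι ℂ) := by
  refine ⟨fun n X hX => ?_, trace_partialTrace⟩
  exact (hX.submatrix (Equiv.prodAssoc (Fin n) ι κ)).partialTrace

/-- The map `X ↦ V * X * Vᴴ`. -/
def conjMap [Fintype ι] (V : Matrix κ ι ℂ) : Matrix ι ι ℂ →ₗ[ℂ] Matrix κ κ ℂ where
  toFun X := V * X * Vᴴ
  map_add' X Y := by rw [Matrix.mul_add, Matrix.add_mul]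
  map_smul' c X := by simp

theorem isQuantumOperation_conjMap [Fintype ι] [DecidableEq ι] [Fintype κ] {V : Matrix κ ι ℂ}
    (hV : Vᴴ * V = 1) : IsQuantumOperation (conjMap V) := by
  refine ⟨fun n X hX => ?_, fun X => ?_⟩
  · have h : idTensor n (conjMap V) X =
        ((1 : Matrix (Fin n) (Fin n) ℂ) ⊗ₖ V) * X * ((1 : Matrix (Fin n) (Fin n) ℂ) ⊗ₖ V)ᴴ := by
      ext ⟨p, a⟩ ⟨q, b⟩
      simp only [idTensor, conjMap, LinearMap.coe_mk, AddHom.coe_mk, Matrix.of_apply,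
        Matrix.mul_apply, Fintype.sum_prod_type, Matrix.conjTranspose_apply,
        Matrix.kroneckerMap_apply, Matrix.one_apply]
      conv_rhs => rw [Finset.sum_comm]
      simp [apply_ite]
    rw [h]
    exact hX.mul_mul_conjTranspose_same _
  · change (V * X * Vᴴ).trace = _
    rw [Matrix.trace_mul_comm, ← Matrix.mul_assoc, hV, Matrix.one_mul]

end Operations

/-! ### The channel rebuilding block states -/

section BlockChannel

variable {n : ℕ} {l r : Fin n → ℕ} {E : Type*}

/-- The operation `X ↦ ⨁ j, tr_{r_j} X_j ⊗ ω j`, where `X_j` are the diagonal blocks of `X`. -/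
noncomputable def blockChannel (ω : ∀ j, Matrix (Fin (r j) × E) (Fin (r j) × E) ℂ) :
    Matrix (Σ j, Fin (l j) × Fin (r j)) (Σ j, Fin (l j) × Fin (r j)) ℂ →ₗ[ℂ]
      Matrix ((Σ j, Fin (l j) × Fin (r j)) × E) ((Σ j, Fin (l j) × Fin (r j)) × E) ℂ where
  toFun X := Matrix.reindex (blockEquiv l r E) (blockEquiv l r E)
    (Matrix.blockDiagonal' fun j => partialTrace (Matrix.blockDiag' X j) ⊗ₖ ω j)
  map_add' X Y := by
    simp only [Matrix.blockDiag'_add, Pi.add_apply, map_add, Matrix.add_kronecker]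
    rw [← Pi.add_def, Matrix.blockDiagonal'_add]
    rfl
  map_smul' c X := by
    simp only [Matrix.blockDiag'_smul, Pi.smul_apply, map_smul, Matrix.smul_kronecker]
    rw [← Pi.smul_def, Matrix.blockDiagonal'_smul]
    rfl

theorem blockChannel_apply (ω : ∀ j, Matrix (Fin (r j) × E) (Fin (r j) × E) ℂ)
    (X : Matrix (Σ j, Fin (l j) × Fin (r j)) (Σ j, Fin (l j) × Fin (r j)) ℂ) :
    blockChannel ω X = Matrix.reindex (blockEquiv l r E) (blockEquiv l r E)
      (Matrix.blockDiagonal' fun j => partialTrace (Matrix.blockDiag' X j) ⊗ₖ ω j) :=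
  rfl

theorem blockChannel_apply_eq (ω : ∀ j, Matrix (Fin (r j) × E) (Fin (r j) × E) ℂ)
    (X : Matrix (Σ j, Fin (l j) × Fin (r j)) (Σ j, Fin (l j) × Fin (r j)) ℂ) (j : Fin n)
    (α β x y) (e e' : E) :
    blockChannel ω X (⟨j, (α, x)⟩, e) (⟨j, (β, y)⟩, e') =
      (∑ z, X ⟨j, (α, z)⟩ ⟨j, (β, z)⟩) * ω j (x, e) (y, e') :=
  Matrix.blockDiagonal'_apply_eq
    (fun j => partialTrace (Matrix.blockDiag' X j) ⊗ₖ ω j) j (α, (x, e)) (β, (y, e'))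

theorem blockChannel_apply_ne (ω : ∀ j, Matrix (Fin (r j) × E) (Fin (r j) × E) ℂ)
    (X : Matrix (Σ j, Fin (l j) × Fin (r j)) (Σ j, Fin (l j) × Fin (r j)) ℂ) {j k : Fin n}
    (hjk : j ≠ k) (α x β y) (e e' : E) :
    blockChannel ω X (⟨j, (α, x)⟩, e) (⟨k, (β, y)⟩, e') = 0 :=
  Matrix.blockDiagonal'_apply_ne
    (fun j => partialTrace (Matrix.blockDiag' X j) ⊗ₖ ω j) (α, (x, e)) (β, (y, e')) hjk

theorem _root_.Matrix.PosSemidef.blockDiagonal' {o : Type*} [Fintype o] [DecidableEq o]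
    {m : o → Type*} [∀ j, Fintype (m j)] {A : ∀ j, Matrix (m j) (m j) ℂ}
    (hA : ∀ j, (A j).PosSemidef) : (Matrix.blockDiagonal' A).PosSemidef := by
  choose Q hQ using fun j => exists_eq_conjTranspose_mul_self (hA j)
  rw [funext hQ, Matrix.blockDiagonal'_mul, ← Matrix.blockDiagonal'_conjTranspose]
  exact Matrix.posSemidef_conjTranspose_mul_self _

theorem isQuantumOperation_blockChannel [Fintype E]
    {ω : ∀ j, Matrix (Fin (r j) × E) (Fin (r j) × E) ℂ} (hω : ∀ j, IsDensity (ω j)) :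
    IsQuantumOperation (blockChannel (l := l) ω) := by
  refine ⟨fun N X hX => ?_, fun X => ?_⟩
  -- The ancilla joins l_j as a spectator, so the output is a submatrix of a direct sum of positive
  -- Kronecker products.
  · let A : ∀ j, Matrix ((Fin N × Fin (l j)) × (Fin (r j) × E))
        ((Fin N × Fin (l j)) × (Fin (r j) × E)) ℂ := fun j =>
      partialTrace (X.submatrix
        (fun p : (Fin N × Fin (l j)) × Fin (r j) => (p.1.1, ⟨j, (p.1.2, p.2)⟩))
        (fun p : (Fin N × Fin (l j)) × Fin (r j) => (p.1.1, ⟨j, (p.1.2, p.2)⟩))) ⊗ₖ ω j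
    have hA : (Matrix.blockDiagonal' A).PosSemidef :=
      Matrix.PosSemidef.blockDiagonal' fun j => ((hX.submatrix _).partialTrace).kronecker (hω j).1
    let g : Fin N × ((Σ j, Fin (l j) × Fin (r j)) × E) →
        Σ j, (Fin N × Fin (l j)) × (Fin (r j) × E) :=
      fun p => ⟨p.2.1.1, ((p.1, p.2.1.2.1), (p.2.1.2.2, p.2.2))⟩
    convert hA.submatrix g using 1
    ext ⟨a, ⟨j, α, x⟩, e⟩ ⟨b, ⟨k, β, y⟩, e'⟩
    by_cases hjk : j = k
    · subst hjk
      exact (blockChannel_apply_eq ω _ j α β x y e e').trans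
        (Matrix.blockDiagonal'_apply_eq A j ((a, α), (x, e)) ((b, β), (y, e'))).symm
    · exact (blockChannel_apply_ne ω _ hjk α x β y e e').trans
        (Matrix.blockDiagonal'_apply_ne A ((a, α), (x, e)) ((b, β), (y, e')) hjk).symm
  · have h : ∀ A : Matrix (Σ j, Fin (l j) × (Fin (r j) × E)) (Σ j, Fin (l j) × (Fin (r j) × E)) ℂ,
        (Matrix.reindex (blockEquiv l r E) (blockEquiv l r E) A).trace = A.trace := fun A =>
      (blockEquiv l r E).symm.sum_comp fun p => A p p
    rw [blockChannel_apply, h]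
    rw [Matrix.trace_blockDiagonal']
    simp only [Matrix.trace_kronecker, (hω _).2, mul_one, trace_partialTrace]
    simp [Matrix.trace, Fintype.sum_sigma, Matrix.blockDiag'_apply]

/-- Since tr ω_j = 1, tracing e and then r_j out of the j-th block leaves exactly p_j σ_j. -/
theorem blockChannel_partialTrace_blockState [Fintype E] {p : Fin n → ℝ}
    {σ : ∀ j, Matrix (Fin (l j)) (Fin (l j)) ℂ}
    {ω : ∀ j, Matrix (Fin (r j) × E) (Fin (r j) × E) ℂ} (hω : ∀ j, IsDensity (ω j)) :
    blockChannel ω (partialTrace (blockState p σ ω)) = blockState p σ ω := by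
  ext ⟨⟨j, α, x⟩, e⟩ ⟨⟨k, β, y⟩, e'⟩
  by_cases hjk : j = k
  · subst hjk
    have h1 := (hω j).2
    rw [Matrix.trace, Fintype.sum_prod_type] at h1
    simp only [Matrix.diag_apply] at h1
    simp only [blockChannel_apply_eq, partialTrace_apply, blockState_apply_eq, ← Finset.mul_sum, h1,
      mul_one, mul_assoc]
  · rw [blockChannel_apply_ne _ _ hjk, blockState_apply_ne _ _ _ hjk]

end BlockChannel

/-! ### The implications between the three statements -/

section Assignment

variable {S E : Type*} [Fintype S] [Fintype E] [DecidableEq S] [DecidableEq E]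
  {D : Set (Matrix (S × E) (S × E) ℂ)}
  {hD : Set.InjOn (partialTrace (σ := S) (ε := E)) D}

omit [Fintype S] [DecidableEq S] [DecidableEq E] in
theorem assignment_partialTrace {ρ : Matrix (S × E) (S × E) ℂ} (hρ : ρ ∈ D)
    (h : partialTrace ρ ∈ reducedStates D) :
    (assignment D hD ⟨partialTrace ρ, h⟩ : Matrix (S × E) (S × E) ℂ) = ρ :=
  congrArg Subtype.val (a₂ := (⟨ρ, hρ⟩ : D))
    ((Equiv.Set.imageOfInjOn partialTrace D hD).symm_apply_eq.2 rfl)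

omit [DecidableEq S] [DecidableEq E] in
theorem hasCPAssignment_iff : HasCPAssignment D hD ↔
    ∃ Φ : Matrix S S ℂ →ₗ[ℂ] Matrix (S × E) (S × E) ℂ, IsQuantumOperation Φ ∧
      ∀ ρ ∈ D, Φ (partialTrace ρ) = ρ := by
  refine exists_congr fun Φ => and_congr_right fun _ => ⟨fun h ρ hρ => ?_, ?_⟩
  · exact (h ⟨partialTrace ρ, Set.mem_image_of_mem _ hρ⟩).trans (assignment_partialTrace hρ _)
  · rintro h ⟨_, ρ, hρ, rfl⟩
    exact (h ρ hρ).trans (assignment_partialTrace hρ _).symm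

theorem HasBlockForm.hasCPAssignment (h : HasBlockForm D) : HasCPAssignment D hD := by
  obtain ⟨n, l, r, V, ω, -, ⟨hV, hV'⟩, hω, hform⟩ := h
  have hW : ((V ⊗ₖ (1 : Matrix E E ℂ))ᴴ)ᴴ * (V ⊗ₖ (1 : Matrix E E ℂ))ᴴ = 1 := by
    rw [Matrix.conjTranspose_conjTranspose, Matrix.conjTranspose_kronecker,
      ← Matrix.mul_kronecker_mul, hV']
    simp
  have hW' : (V ⊗ₖ (1 : Matrix E E ℂ))ᴴ * (V ⊗ₖ (1 : Matrix E E ℂ)) = 1 := by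
    rw [Matrix.conjTranspose_kronecker, ← Matrix.mul_kronecker_mul, hV]
    simp
  refine hasCPAssignment_iff.2 ⟨conjMap (V ⊗ₖ (1 : Matrix E E ℂ))ᴴ ∘ₗ blockChannel ω ∘ₗ conjMap V,
    (isQuantumOperation_conjMap hW).comp
      ((isQuantumOperation_blockChannel hω).comp (isQuantumOperation_conjMap hV)), ?_⟩
  intro ρ hρ
  obtain ⟨p, σ, -, -, -, hσ⟩ := hform ρ hρ
  change (V ⊗ₖ (1 : Matrix E E ℂ))ᴴ * blockChannel ω (V * partialTrace ρ * Vᴴ) *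
    ((V ⊗ₖ (1 : Matrix E E ℂ))ᴴ)ᴴ = ρ
  rw [← partialTrace_kronecker_one_conj, hσ, blockChannel_partialTrace_blockState hω, ← hσ,
    Matrix.conjTranspose_conjTranspose]
  simp only [Matrix.mul_assoc, hW', Matrix.mul_one]
  rw [← Matrix.mul_assoc, hW', Matrix.one_mul]

theorem HasCPAssignment.guaranteesCP (h : HasCPAssignment D hD) : GuaranteesCP D hD := by
  obtain ⟨Φ, hΦ, hΛ⟩ := h
  intro s' e' W U hW hU
  refine ⟨partialTrace ∘ₗ conjMap W ∘ₗ conjMap U ∘ₗ Φ, isQuantumOperation_partialTrace.comp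
    ((isQuantumOperation_conjMap hW.1).comp ((isQuantumOperation_conjMap hU.1).comp hΦ)),
    fun ρ => ?_⟩
  simp only [LinearMap.comp_apply, hΛ]
  rfl

theorem GuaranteesCP.hasCPAssignment (h : GuaranteesCP D hD) : HasCPAssignment D hD := by
  -- The final system is the whole of S × E and the final environment is `Fin 1`, so the partial
  -- trace discards nothing.
  let f : Fin (Fintype.card (S × E)) × Fin 1 ≃ S × E :=
    (Equiv.prodUnique _ _).trans (Fintype.equivFin (S × E)).symm
  let W : Matrix (Fin (Fintype.card (S × E)) × Fin 1) (S × E) ℂ :=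
    (1 : Matrix (S × E) (S × E) ℂ).submatrix f id
  -- Undoes the enumeration of S × E, bringing the output back to the original space.
  let W' : Matrix (S × E) (Fin (Fintype.card (S × E))) ℂ :=
    (1 : Matrix (S × E) (S × E) ℂ).submatrix id (Fintype.equivFin (S × E)).symm
  have hW : IsUnitaryMap W := by
    have hWt : Wᴴ = (1 : Matrix (S × E) (S × E) ℂ).submatrix id f := by
      simp [W, Matrix.conjTranspose_submatrix]
    rw [IsUnitaryMap, hWt]
    constructor
    · rw [Matrix.submatrix_mul_equiv]
      simp
    · simpa using Matrix.submatrix_mul_equiv (1 : Matrix (S × E) (S × E) ℂ) 1 f (Equiv.refl _) f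
  have hW' : W'ᴴ * W' = 1 := by
    have hWt : W'ᴴ = (1 : Matrix (S × E) (S × E) ℂ).submatrix (Fintype.equivFin (S × E)).symm id := by
      simp [W', Matrix.conjTranspose_submatrix]
    rw [hWt]
    simpa using Matrix.submatrix_mul_equiv (1 : Matrix (S × E) (S × E) ℂ) 1
      (Fintype.equivFin (S × E)).symm (Equiv.refl _) (Fintype.equivFin (S × E)).symm
  obtain ⟨Φ, hΦ, hΛ⟩ := h _ _ W 1 hW (by simp [IsUnitaryMap])
  refine ⟨conjMap W' ∘ₗ Φ, (isQuantumOperation_conjMap hW').comp hΦ, fun ρ => ?_⟩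
  rw [LinearMap.comp_apply, hΛ]
  change W' * partialTrace (W * (1 * (assignment D hD ρ : Matrix (S × E) (S × E) ℂ) * 1ᴴ) * Wᴴ) *
    W'ᴴ = (assignment D hD ρ : Matrix (S × E) (S × E) ℂ)
  generalize (assignment D hD ρ : Matrix (S × E) (S × E) ℂ) = X
  have hWX : W * (1 * X * 1ᴴ) * Wᴴ = X.submatrix f f := by
    ext p q
    simp [W, Matrix.mul_apply, Matrix.one_apply]
  rw [hWX]
  ext p q
  simp [W', f, Matrix.mul_apply, Matrix.one_apply, partialTrace_apply, Equiv.symm_apply_eq,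
    Equiv.eq_symm_apply]

end Assignment

end ReducedDynamics

theorem proposition1 {S E : Type*} [Fintype S] [Fintype E] [DecidableEq S] [DecidableEq E]
    (D : Set (Matrix (S × E) (S × E) ℂ))
    (hstates : ∀ ρ ∈ D, ReducedDynamics.IsDensity ρ)
    (hD : Set.InjOn (ReducedDynamics.partialTrace (σ := S) (ε := E)) D) :
    List.TFAE [ReducedDynamics.GuaranteesCP D hD,
      ReducedDynamics.HasCPAssignment D hD,
      ReducedDynamics.HasBlockForm D] := by
  tfae_have 1 → 2 := fun h => h.hasCPAssignment
  tfae_have 2 → 1 := fun h => h.guaranteesCP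
  tfae_have 3 → 2 := fun h => h.hasCPAssignment
  tfae_have 2 → 3 := fun h => by
    obtain ⟨Φ, hΦ, hΛ⟩ := ReducedDynamics.hasCPAssignment_iff.1 h
    exact ReducedDynamics.hasBlockForm_of_isQuantumOperation hstates hΦ hΛ
  tfae_finish
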